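/- For $n\ge 1$ let $B_n^+$ be the monoid of positive $n$-strand braids, i.e. the monoid generated by $\sigma_1,\dots,\sigma_{n-1}$ subject to $\sigma_i\sigma_j=\sigma_j\sigma_i$ for $|i-j|\ge 2$ and $\sigma_i\sigma_j\sigma_i=\sigma_j\sigma_i\sigma_j$ for $|i-j|=1$. Put $\Delta_0=\Delta_1=1$ and $\Delta_r=\sigma_1\sigma_2\cdots\sigma_{r-1}\Delta_{r-1}$ for $2\le r\le n$. A braid in $B_n^+$ is called simple if it is a left divisor of $\Delta_n$, and a sequence $(x_1,\dots,x_d)$ of simple braids is called normal if, for each $k$, $x_k$ is the greatest common left divisor of $\Delta_n$ and $x_kx_{k+1}\cdots x_d$. The normal form of $x\in B_n^+$ is the normal sequence with product $x$, completed on the right by infinitely many factors $1$; $x$ has degree at most $d$ if all factors after the $d$-th are $1$. For $d\ge1$ and a simple braid $y$, let $b_{n,d}(y)$ be the number of $x\in B_n^+$ of degree at most $d$ whose $d$-th factor is $y$. Then the numbers $u_n=b_{n,4}(\Delta_{n-1})$, $n\ge 1$, satisfy $$u_1=1,\qquad u_n=n\,u_{n-1}+n\quad(n\ge 2),$$ and,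 for every $n\ge 1$, $$b_{n,4}(\Delta_{n-1})=\lfloor n!\,e\rfloor-1 .$$ -/

import Mathlib

/-- The braid relations on the generators `σ_1, …, σ_{n-1}`; the index `i : Fin (n - 1)`
stands for the generator `σ_{i+1}`. -/
inductive BraidRel (n : ℕ) : FreeMonoid (Fin (n - 1)) → FreeMonoid (Fin (n - 1)) → Prop
  /-- `σ_i σ_j = σ_j σ_i` for `|i - j| ≥ 2` -/
  | comm (i j : Fin (n - 1)) (h : (i : ℕ) + 2 ≤ j ∨ (j : ℕ) + 2 ≤ i) :
      BraidRel n (FreeMonoid.of i * FreeMonoid.of j) (FreeMonoid.of j * FreeMonoid.of i)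
  /-- `σ_i σ_j σ_i = σ_j σ_i σ_j` for `|i - j| = 1` -/
  | braid (i j : Fin (n - 1)) (h : (i : ℕ) + 1 = j ∨ (j : ℕ) + 1 = i) :
      BraidRel n (FreeMonoid.of i * FreeMonoid.of j * FreeMonoid.of i)
        (FreeMonoid.of j * FreeMonoid.of i * FreeMonoid.of j)

/-- The monoid `B_n^+` of positive `n`-strand braids. -/
abbrev BraidMonoid (n : ℕ) : Type := PresentedMonoid (BraidRel n)

namespace BraidMonoid

/-- The generator `σ_{i+1}` of `B_n^+`. -/
def sigma {n : ℕ} (i : Fin (n - 1)) : BraidMonoid n := PresentedMonoid.of (BraidRel n) i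

/-- The braid `Δ_r`, seen in `B_n^+` for `r ≤ n`:
`Δ_0 = Δ_1 = 1` and `Δ_r = σ_1 σ_2 ⋯ σ_{r-1} Δ_{r-1}`. -/
def Delta (n : ℕ) : (r : ℕ) → r ≤ n → BraidMonoid n
  | 0, _ => 1
  | r + 1, h =>
      (List.ofFn fun i : Fin r => sigma (⟨i, by omega⟩ : Fin (n - 1))).prod *
        Delta n r (Nat.le_of_succ_le h)

/-- `g` is the greatest common left divisor of `a` and `b`. In a monoid, `x ∣ y` means
`∃ z, y = x * z`, that is, `x` is a left divisor of `y`. -/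
def IsLeftGcd {n : ℕ} (a b g : BraidMonoid n) : Prop :=
  g ∣ a ∧ g ∣ b ∧ ∀ h : BraidMonoid n, h ∣ a → h ∣ b → h ∣ g

/-- A simple `n`-braid is a divisor of `Δ_n` in `B_n^+`. -/
def IsSimple {n : ℕ} (x : BraidMonoid n) : Prop := x ∣ Delta n n le_rfl

/-- A sequence `(x_1, …, x_d)` is normal if every `x_k` is simple and is the greatest common
left divisor of `Δ_n` and `x_k x_{k+1} ⋯ x_d`. -/
def IsNormal {n : ℕ} : List (BraidMonoid n) → Prop
  | [] => True
  | x :: L => IsSimple x ∧ IsLeftGcd (Delta n n le_rfl) (x * L.prod) x ∧ IsNormal L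

/-- `s 0, s 1, s 2, …` is the normal form of `x`, completed by infinitely many trivial factors:
`s k` is the `(k+1)`-st factor. -/
def IsNormalForm {n : ℕ} (x : BraidMonoid n) (s : ℕ → BraidMonoid n) : Prop :=
  ∃ N : ℕ, IsNormal ((List.range N).map s) ∧ ((List.range N).map s).prod = x ∧
    ∀ k, N ≤ k → s k = 1

/-- `x` has degree at most `d`: all factors of its normal form after the `d`-th are trivial. -/
def DegreeLE {n : ℕ} (x : BraidMonoid n) (d : ℕ) : Prop :=
  ∃ s, IsNormalForm x s ∧ ∀ k, d ≤ k → s k = 1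

/-- For `d ≥ 1`, the `d`-th factor of the normal form of `x` is `y`. -/
def IsFactor {n : ℕ} (x : BraidMonoid n) (d : ℕ) (y : BraidMonoid n) : Prop :=
  ∃ s, IsNormalForm x s ∧ s (d - 1) = y

/-- For `d ≥ 1`, the number `b_{n,d}(y)` of positive `n`-strand braids of degree at most `d`
whose `d`-th factor is `y`. -/
noncomputable def numBraids (n d : ℕ) (y : BraidMonoid n) : ℕ :=
  Nat.card {x : BraidMonoid n // DegreeLE x d ∧ IsFactor x d y}

end BraidMonoid

/-! Simple braids correspond to the permutations of `n` points, and a sequence of simple braids is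
normal exactly when every left descent of a factor is a right descent of the factor before it
(`isSimple_iff_reduced`, `isNormal_cons_cons`). This rests on Garside's analysis of common multiples
of generators (`exists_of_sigma_mul_eq`), which gives left cancellation, lcms and gcds. Since normal
forms are unique, b_{n,4}(Δ_{n-1}) counts triples (u, v, w) of permutations in which v may follow u,
w may follow v, and Δ_{n-1} may follow w (`numBraids_four`).

Two of the three entries can be parametrised by sets. The permutation of Δ_{n-1} has every left
descent except the last, so w lists the complement of a point k in decreasing order and then k. With
points numbered from 0, the left descents of w are all except the pair (k-1, k), so v lists a
k-element set A in decreasing order and then its complement in decreasing order. As k runs from 0 to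
n-1, A runs over the proper subsets. What remains is u, which must descend at each i unless i ∈ A
and i+1 ∉ A. The full set would contribute one further u, the reversal; hence u_n + 1 is the number
of pairs (A, u) (`numBraids_four_delta_pred`).

Such a pair is a word with some letters marked, whose ascents all go from a marked letter to an
unmarked one. When it is built from left to right, only the last mark and the number of remaining
letters below the last letter matter. Hockey-stick summation solves the resulting recursion
(`numMarked_eq`), and the total is S_n = Σ_k C(n,k)(n-k)! = Σ_{k≤n} n!/k!. Then S_{n+1} = (n+1) S_n
+ 1, and S_n = ⌊n! e⌋ for n ≥ 1 because the tail of the exponential series, times n!, is below 1. -/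

namespace BraidMonoid

variable {n : ℕ}

/-! ### Length of positive braids. -/

/-- The length of a positive braid, as a homomorphism. -/
def lenHom (n : ℕ) : BraidMonoid n →* Multiplicative ℕ :=
  PresentedMonoid.lift (fun _ => Multiplicative.ofAdd 1) (by
    rintro a b (⟨i, j, h⟩ | ⟨i, j, h⟩) <;> simp)

/-- The length of a positive braid. -/
def len (x : BraidMonoid n) : ℕ := Multiplicative.toAdd (lenHom n x)

@[simp] lemma len_one : len (1 : BraidMonoid n) = 0 := by simp [len]

@[simp] lemma len_mul (x y : BraidMonoid n) : len (x * y) = len x + len y := by simp [len]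

@[simp] lemma len_sigma (i : Fin (n - 1)) : len (sigma i : BraidMonoid n) = 1 := by
  simp [len, lenHom, sigma]

/-- Every braid is trivial or starts with a generator. -/
lemma eq_one_or_eq_sigma_mul (x : BraidMonoid n) : x = 1 ∨ ∃ i y, x = sigma i * y := by
  induction x using PresentedMonoid.inductionOn with
  | _ a =>
    cases a using FreeMonoid.casesOn with
    | one => left; simp
    | of_mul i a => right; exact ⟨i, PresentedMonoid.mk _ a, by simp [sigma, PresentedMonoid.of]⟩

lemma induction_sigma {p : BraidMonoid n → Prop} (one : p 1)
    (mul : ∀ i x, p x → p (sigma i * x)) (x : BraidMonoid n) : p x := by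
  induction h : len x generalizing x with
  | zero =>
    rcases eq_one_or_eq_sigma_mul x with rfl | ⟨i, y, rfl⟩
    · exact one
    · simp at h
  | succ m ih =>
    rcases eq_one_or_eq_sigma_mul x with rfl | ⟨i, y, rfl⟩
    · exact one
    · exact mul i y (ih y (by simp at h; omega))

lemma len_eq_zero {x : BraidMonoid n} : len x = 0 ↔ x = 1 := by
  refine ⟨fun h => ?_, by rintro rfl; simp⟩
  rcases eq_one_or_eq_sigma_mul x with rfl | ⟨i, y, rfl⟩
  · rfl
  · simp at h

/-! ### Common right multiples of two generators. -/

/-- Two generator indices are far apart. -/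
def Far (i j : Fin (n - 1)) : Prop := (i : ℕ) + 2 ≤ j ∨ (j : ℕ) + 2 ≤ i

/-- Two generator indices are adjacent. -/
def Adj (i j : Fin (n - 1)) : Prop := (i : ℕ) + 1 = j ∨ (j : ℕ) + 1 = i

lemma Far.symm {i j : Fin (n - 1)} (h : Far i j) : Far j i := Or.symm h
lemma Adj.symm {i j : Fin (n - 1)} (h : Adj i j) : Adj j i := Or.symm h

lemma eq_or_far_or_adj (i j : Fin (n - 1)) : i = j ∨ Far i j ∨ Adj i j := by
  unfold Far Adj; rw [Fin.ext_iff]; omega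

lemma Far.ne {i j : Fin (n - 1)} (h : Far i j) : i ≠ j := by
  rintro rfl; unfold Far at h; omega
lemma Adj.ne {i j : Fin (n - 1)} (h : Adj i j) : i ≠ j := by
  rintro rfl; unfold Adj at h; omega
lemma Far.not_adj {i j : Fin (n - 1)} (h : Far i j) : ¬ Adj i j := by
  unfold Far at h; unfold Adj; omega

lemma Far.comm {i j : Fin (n - 1)} (h : Far i j) (z : BraidMonoid n) :
    sigma i * (sigma j * z) = sigma j * (sigma i * z) := by
  have : (sigma i * sigma j : BraidMonoid n) = sigma j * sigma i := by
    have := PresentedMonoid.mk_eq_mk_of_rel (BraidRel.comm i j h)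
    simpa [sigma, PresentedMonoid.of] using this
  rw [← mul_assoc, this, mul_assoc]

lemma Adj.braid {i j : Fin (n - 1)} (h : Adj i j) (z : BraidMonoid n) :
    sigma i * (sigma j * (sigma i * z)) = sigma j * (sigma i * (sigma j * z)) := by
  have : (sigma i * sigma j * sigma i : BraidMonoid n) = sigma j * sigma i * sigma j := by
    have := PresentedMonoid.mk_eq_mk_of_rel (BraidRel.braid i j h)
    simpa [sigma, PresentedMonoid.of] using this
  rw [← mul_assoc, ← mul_assoc, this, mul_assoc, mul_assoc]

open scoped Classical in
/-- The complement of `σ_i` in the least common right multiple of `σ_i` and `σ_j`. -/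
noncomputable def compl (i j : Fin (n - 1)) : BraidMonoid n :=
  if i = j then 1 else if Adj i j then sigma j * sigma i else sigma j

@[simp] lemma compl_self (i : Fin (n - 1)) : compl i i = 1 := by simp [compl]
lemma Far.compl {i j : Fin (n - 1)} (h : Far i j) : compl i j = sigma j := by
  simp [BraidMonoid.compl, h.ne, h.not_adj]
lemma Adj.compl {i j : Fin (n - 1)} (h : Adj i j) : compl i j = sigma j * sigma i := by
  simp [BraidMonoid.compl, h.ne, h]

lemma sigma_mul_compl (i j : Fin (n - 1)) :
    sigma i * compl i j = sigma j * compl j i := by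
  rcases eq_or_far_or_adj i j with rfl | h | h
  · rfl
  · simpa [h.compl, h.symm.compl] using h.comm 1
  · simpa [h.compl, h.symm.compl] using h.braid 1

/-- The common right multiples of two generators `σ_i`, `σ_j`, in total length at most `l`,
are multiples of the least one. -/
def SigmaLcmUpTo (n l : ℕ) : Prop :=
  ∀ (i j : Fin (n - 1)) (x y : BraidMonoid n), sigma i * x = sigma j * y → len x + 1 ≤ l →
    ∃ z, x = compl i j * z ∧ y = compl j i * z

lemma SigmaLcmUpTo.cancel {l : ℕ} (H : SigmaLcmUpTo n l) {i : Fin (n - 1)} {x y : BraidMonoid n}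
    (h : sigma i * x = sigma i * y) (hl : len x + 1 ≤ l) : x = y := by
  obtain ⟨z, rfl, rfl⟩ := H i i x y h hl
  rfl

lemma SigmaLcmUpTo.far {l : ℕ} (H : SigmaLcmUpTo n l) {i j : Fin (n - 1)} (hij : Far i j)
    {x y : BraidMonoid n} (h : sigma i * x = sigma j * y) (hl : len x + 1 ≤ l) :
    ∃ z, x = sigma j * z ∧ y = sigma i * z := by
  simpa only [hij.compl, hij.symm.compl] using H i j x y h hl

lemma SigmaLcmUpTo.adj {l : ℕ} (H : SigmaLcmUpTo n l) {i j : Fin (n - 1)} (hij : Adj i j)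
    {x y : BraidMonoid n} (h : sigma i * x = sigma j * y) (hl : len x + 1 ≤ l) :
    ∃ z, x = sigma j * (sigma i * z) ∧ y = sigma i * (sigma j * z) := by
  simpa only [hij.compl, hij.symm.compl, mul_assoc] using H i j x y h hl

lemma len_eq_of_sigma_mul_eq {i j : Fin (n - 1)} {x y : BraidMonoid n}
    (h : sigma i * x = sigma j * y) : len x = len y := by
  simpa using congrArg len h

lemma trans_far_far {l : ℕ} (H : SigmaLcmUpTo n l) {i j k : Fin (n - 1)} (hki : Far k i)
    (hkj : Far k j) {x y : BraidMonoid n} (h : sigma i * x = sigma j * y) (hl : len x + 1 ≤ l) :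
    ∃ z, sigma k * x = compl i j * z ∧ sigma k * y = compl j i * z := by
  obtain ⟨z, rfl, rfl⟩ := H i j x y h hl
  refine ⟨sigma k * z, ?_, ?_⟩ <;> rcases eq_or_far_or_adj i j with rfl | hij | hij
  · simp
  · rw [hij.compl, hkj.comm]
  · simp only [hij.compl, mul_assoc]; rw [hkj.comm, hki.comm]
  · simp
  · rw [hij.symm.compl, hki.comm]
  · simp only [hij.symm.compl, mul_assoc]; rw [hki.comm, hkj.comm]

lemma trans_far_adj {l : ℕ} (H : SigmaLcmUpTo n l) {i j k : Fin (n - 1)} (hki : Far k i)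
    (hkj : Adj k j) {x y : BraidMonoid n} (h : sigma i * x = sigma j * (sigma k * y))
    (hl : len x + 1 ≤ l) :
    ∃ z, sigma k * x = compl i j * z ∧ sigma k * (sigma j * y) = compl j i * z := by
  have hxy : len x = len y + 1 := by simpa [add_comm] using len_eq_of_sigma_mul_eq h
  rcases eq_or_far_or_adj i j with rfl | hij | hij
  · exact absurd hkj hki.not_adj
  · obtain ⟨z, rfl, hz⟩ := H.far hij h hl
    obtain ⟨w, rfl, rfl⟩ := H.far hki hz (by simp at hl hxy ⊢; omega)
    refine ⟨sigma k * (sigma j * w), ?_, ?_⟩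
    · rw [hij.compl, hkj.braid]
    · rw [hij.symm.compl, hij.symm.comm, hki.comm]
  · obtain ⟨v, rfl, hv⟩ := H.adj hij h hl
    obtain ⟨v', rfl, hv'⟩ := H.far hki hv (by simp at hl hxy ⊢; omega)
    obtain ⟨w, rfl, rfl⟩ := H.adj hkj.symm hv' (by simp at hl hxy ⊢; omega)
    refine ⟨sigma k * (sigma j * (sigma i * w)), ?_, ?_⟩
    · simp only [hij.compl, mul_assoc]
      rw [hki.symm.comm, hkj.braid, hij.symm.braid, hki.comm]
    · simp only [hij.symm.compl, mul_assoc]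
      rw [hij.symm.braid, hki.comm, hki.symm.comm w, hkj.braid]

lemma trans_adj_adj {l : ℕ} (H : SigmaLcmUpTo n l) {i j k : Fin (n - 1)} (hki : Adj k i)
    (hkj : Adj k j) {x y : BraidMonoid n} (h : sigma i * (sigma k * x) = sigma j * (sigma k * y))
    (hl : len x + 2 ≤ l) :
    ∃ z, sigma k * (sigma i * x) = compl i j * z ∧ sigma k * (sigma j * y) = compl j i * z := by
  have hxy : len x = len y := by simpa using congrArg len h
  rcases eq_or_far_or_adj i j with rfl | hij | hij
  · exact ⟨sigma k * (sigma i * x), by simp,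
      by simp [H.cancel (H.cancel h (by simp; omega)) (by omega)]⟩
  · obtain ⟨v, hv1, hv2⟩ := H.far hij h (by simp; omega)
    have hlv : len x = len v := len_eq_of_sigma_mul_eq hv1
    obtain ⟨p, rfl, rfl⟩ := H.adj hkj hv1 (by omega)
    obtain ⟨q, rfl, hq⟩ := H.adj hki hv2 (by omega)
    simp only [len_mul, len_sigma] at hl hlv hxy
    obtain ⟨r, rfl, rfl⟩ := H.far hij.symm (H.cancel hq (by simp; omega)) (by omega)
    refine ⟨sigma k * (sigma j * (sigma i * (sigma k * r))), ?_, ?_⟩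
    · rw [hij.compl, hij.comm, ← hki.braid, hkj.braid]
    · rw [hij.symm.compl, hij.symm.comm, ← hkj.braid, hki.braid, hij.comm]
  -- Two neighbours of `k` have indices of equal parity, so they cannot be adjacent.
  · unfold Adj at *; omega

/-- The coherence condition for three generators: it lets an equality between braids starting with
`σ_i` and `σ_j` be deduced through an intermediate word starting with `σ_k`. The common tail after
`σ_k` is shorter, so the lcm property is needed only up to its length. -/
lemma sigmaLcm_trans {l : ℕ} (H : SigmaLcmUpTo n l) {i j k : Fin (n - 1)} {x y : BraidMonoid n}
    (h : compl k i * x = compl k j * y) (hl : len (compl k i * x) ≤ l) :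
    ∃ z, compl i k * x = compl i j * z ∧ compl j k * y = compl j i * z := by
  rcases eq_or_far_or_adj k i with rfl | hki | hki
  · simp only [compl_self, one_mul] at h ⊢
    exact ⟨y, h, rfl⟩
  · rcases eq_or_far_or_adj k j with rfl | hkj | hkj
    · simp only [compl_self, one_mul] at h ⊢
      exact ⟨x, rfl, h.symm⟩
    · rw [hki.compl, hkj.compl] at h
      rw [hki.symm.compl, hkj.symm.compl]
      rw [hki.compl] at hl
      exact trans_far_far H hki hkj h (by simpa [add_comm] using hl)
    · rw [hki.compl, hkj.compl, mul_assoc] at h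
      rw [hki.symm.compl, hkj.symm.compl, mul_assoc]
      rw [hki.compl] at hl
      exact trans_far_adj H hki hkj h (by simpa [add_comm] using hl)
  · rcases eq_or_far_or_adj k j with rfl | hkj | hkj
    · simp only [compl_self, one_mul] at h ⊢
      exact ⟨x, rfl, h.symm⟩
    · rw [h] at hl
      rw [hki.compl, hkj.compl, mul_assoc] at h
      rw [hki.symm.compl, hkj.symm.compl, mul_assoc]
      rw [hkj.compl] at hl
      obtain ⟨z, h1, h2⟩ := trans_far_adj H hkj hki h.symm (by simpa [add_comm] using hl)
      exact ⟨z, h2, h1⟩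
    · rw [hki.compl, hkj.compl, mul_assoc, mul_assoc] at h
      rw [hki.symm.compl, hkj.symm.compl, mul_assoc, mul_assoc]
      rw [hki.compl] at hl
      simp at hl
      exact trans_adj_adj H hki hkj h (by omega)

/-- Words representing the same braid, through their first letters. -/
def HeadCompat (n l : ℕ) (u v : FreeMonoid (Fin (n - 1))) : Prop :=
  u.length ≤ l → ∀ (i j : Fin (n - 1)) (x y : FreeMonoid (Fin (n - 1))),
    u = FreeMonoid.of i * x → v = FreeMonoid.of j * y →
    ∃ z, PresentedMonoid.mk (BraidRel n) x = compl i j * z ∧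
      PresentedMonoid.mk (BraidRel n) y = compl j i * z

lemma len_mk (u : FreeMonoid (Fin (n - 1))) : len (PresentedMonoid.mk (BraidRel n) u) = u.length := by
  induction u using FreeMonoid.recOn with
  | one => simp
  | of_mul i u ih =>
    rw [map_mul, len_mul, ih]
    change len (sigma i) + _ = _
    simp

lemma mk_of (i : Fin (n - 1)) : PresentedMonoid.mk (BraidRel n) (FreeMonoid.of i) = sigma i := rfl

lemma of_mul_cancel {i j : Fin (n - 1)} {x y : FreeMonoid (Fin (n - 1))}
    (h : FreeMonoid.of i * x = FreeMonoid.of j * y) : i = j ∧ x = y := by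
  have := congrArg FreeMonoid.toList h
  simpa using this

lemma eq_one_or_eq_of_mul (u : FreeMonoid (Fin (n - 1))) :
    u = 1 ∨ ∃ i x, u = FreeMonoid.of i * x := by
  cases u using FreeMonoid.casesOn with
  | one => exact .inl rfl
  | of_mul i a => exact .inr ⟨i, a, rfl⟩

/-- Induction on the derivation of `u = v` from the braid relations. Transitivity is the only case
that uses `H`: removing the head of the middle word lowers the length from `l + 1` to `l`, where
`sigmaLcm_trans` applies. In a product the heads lie in the left factors, unless these are both
empty, since relations preserve length. -/
lemma headCompat_of_rel {l : ℕ} (H : SigmaLcmUpTo n l) {u v : FreeMonoid (Fin (n - 1))}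
    (h : ConGen.Rel (BraidRel n) u v) : HeadCompat n (l + 1) u v := by
  have hmk : ∀ {u v}, ConGen.Rel (BraidRel n) u v →
      PresentedMonoid.mk (BraidRel n) u = PresentedMonoid.mk (BraidRel n) v :=
    fun h => PresentedMonoid.mk_eq_mk_iff.2 h
  have hlen : ∀ {u v}, ConGen.Rel (BraidRel n) u v → u.length = v.length := fun h => by
    rw [← len_mk, ← len_mk, hmk h]
  induction h with
  | of u v h =>
    rintro - i' j' x y hx hy
    cases h with
    | comm i j h =>
      obtain ⟨rfl, rfl⟩ := of_mul_cancel hx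
      obtain ⟨rfl, rfl⟩ := of_mul_cancel hy
      have h : Far i j := h
      exact ⟨1, by simp [h.compl, mk_of], by simp [h.symm.compl, mk_of]⟩
    | braid i j h =>
      rw [mul_assoc] at hx hy
      obtain ⟨rfl, rfl⟩ := of_mul_cancel hx
      obtain ⟨rfl, rfl⟩ := of_mul_cancel hy
      have h : Adj i j := h
      exact ⟨1, by simp [h.compl, mk_of], by simp [h.symm.compl, mk_of]⟩
  | refl u =>
    rintro - i j x y rfl hy
    obtain ⟨rfl, rfl⟩ := of_mul_cancel hy
    exact ⟨PresentedMonoid.mk _ x, by simp, by simp⟩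
  | symm h ih =>
    rintro hl i j x y hx hy
    obtain ⟨z, h1, h2⟩ := ih (by rw [hlen h]; exact hl) j i y x hy hx
    exact ⟨z, h2, h1⟩
  | trans h1 h2 ih1 ih2 =>
    rename_i u v w
    rintro hl i j x y rfl rfl
    rcases eq_one_or_eq_of_mul v with rfl | ⟨k, t, rfl⟩
    · have := hlen h1
      simp at this
    · have hl1 := hlen h1
      obtain ⟨z1, hx, ht1⟩ := ih1 hl i k x t rfl rfl
      obtain ⟨z2, ht2, hy⟩ := ih2 (by omega) k j t y rfl rfl
      rw [hx, hy]
      refine sigmaLcm_trans H (ht1.symm.trans ht2) ?_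
      rw [← ht1, len_mk]
      simp at hl hl1
      omega
  | mul h1 h2 ih1 ih2 =>
    rename_i u1 v1 u2 v2
    rintro hl i j x y hx hy
    have hl1 := hlen h1
    simp only [FreeMonoid.length_mul] at hl
    rcases eq_one_or_eq_of_mul u1 with rfl | ⟨i', x', rfl⟩
    · obtain rfl : v1 = 1 := by
        rw [← FreeMonoid.length_eq_zero]; simpa using hl1.symm
      rw [one_mul] at hx hy
      exact ih2 (by omega) i j x y hx hy
    · rcases eq_one_or_eq_of_mul v1 with rfl | ⟨j', y', rfl⟩
      · simp at hl1
      · rw [mul_assoc] at hx hy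
        obtain ⟨rfl, rfl⟩ := of_mul_cancel hx
        obtain ⟨rfl, rfl⟩ := of_mul_cancel hy
        obtain ⟨z, hz1, hz2⟩ := ih1 (by omega) i' j' x' y' rfl rfl
        refine ⟨z * PresentedMonoid.mk _ u2, ?_, ?_⟩
        · rw [map_mul, hz1, mul_assoc]
        · rw [map_mul, hz2, mul_assoc, hmk h2]

lemma sigmaLcmUpTo (n l : ℕ) : SigmaLcmUpTo n l := by
  induction l with
  | zero => intro i j x y _ h; omega
  | succ l ih =>
    intro i j x y h hl
    induction x using PresentedMonoid.inductionOn with | _ x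
    induction y using PresentedMonoid.inductionOn with | _ y
    rw [← mk_of, ← mk_of, ← map_mul, ← map_mul, PresentedMonoid.mk_eq_mk_iff] at h
    refine headCompat_of_rel ih h ?_ i j x y rfl rfl
    rw [len_mk] at hl
    simp; omega

/-- `σ_i` and `σ_j` have a least common right multiple. -/
theorem exists_of_sigma_mul_eq {i j : Fin (n - 1)} {x y : BraidMonoid n}
    (h : sigma i * x = sigma j * y) : ∃ z, x = compl i j * z ∧ y = compl j i * z :=
  sigmaLcmUpTo n (len x + 1) i j x y h le_rfl

/-! ### Left cancellation, lcms and gcds. -/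

theorem mul_left_cancel' {a x y : BraidMonoid n} (h : a * x = a * y) : x = y := by
  induction a using induction_sigma with
  | one => simpa using h
  | mul i a ih =>
    rw [mul_assoc, mul_assoc] at h
    obtain ⟨z, h1, h2⟩ := exists_of_sigma_mul_eq h
    exact ih (by simpa using h1.trans (by simpa using h2.symm))

lemma dvd_of_mul_dvd_mul {a x y : BraidMonoid n} (h : a * x ∣ a * y) : x ∣ y := by
  obtain ⟨z, hz⟩ := h
  exact ⟨z, mul_left_cancel' (hz.trans (mul_assoc _ _ _))⟩

lemma mul_dvd_mul_left' {x y : BraidMonoid n} (a : BraidMonoid n) (h : x ∣ y) : a * x ∣ a * y := by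
  obtain ⟨z, rfl⟩ := h
  exact ⟨z, (mul_assoc _ _ _).symm⟩

lemma len_le_of_dvd {x y : BraidMonoid n} (h : x ∣ y) : len x ≤ len y := by
  obtain ⟨z, rfl⟩ := h
  simp

lemma dvd_antisymm' {x y : BraidMonoid n} (h : x ∣ y) (h' : y ∣ x) : x = y := by
  obtain ⟨z, rfl⟩ := h
  have := len_le_of_dvd h'
  simp only [len_mul] at this
  rw [len_eq_zero.1 (by omega : len z = 0), mul_one]

/-- `l` is a least common right multiple of `a` and `b`. -/
def IsRightLcm (a b l : BraidMonoid n) : Prop :=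
  a ∣ l ∧ b ∣ l ∧ ∀ m, a ∣ m → b ∣ m → l ∣ m

lemma IsRightLcm.mul_left {a b l : BraidMonoid n} (h : IsRightLcm a b l) (c : BraidMonoid n) :
    IsRightLcm (c * a) (c * b) (c * l) := by
  refine ⟨mul_dvd_mul_left' c h.1, mul_dvd_mul_left' c h.2.1, fun m ha hb => ?_⟩
  obtain ⟨m', rfl⟩ := dvd_of_mul_right_dvd ha
  exact mul_dvd_mul_left' c (h.2.2 m' (dvd_of_mul_dvd_mul ha) (dvd_of_mul_dvd_mul hb))

lemma isRightLcm_sigma (i j : Fin (n - 1)) :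
    IsRightLcm (sigma i) (sigma j) (sigma i * compl i j) := by
  refine ⟨dvd_mul_right _ _, ⟨compl j i, sigma_mul_compl i j⟩, ?_⟩
  rintro m ⟨x, rfl⟩ ⟨y, hy⟩
  obtain ⟨z, rfl, -⟩ := exists_of_sigma_mul_eq hy
  exact ⟨z, (mul_assoc _ _ _).symm⟩

/-- Induction on the length of a common multiple. Two elements with the same first generator reduce
to shorter ones by cancelling it. -/
theorem exists_isRightLcm {a b m : BraidMonoid n} (ha : a ∣ m) (hb : b ∣ m) :
    ∃ l, IsRightLcm a b l := by
  induction hN : len m using Nat.strong_induction_on generalizing a b m with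
  | _ N ih =>
    rcases eq_one_or_eq_sigma_mul a with rfl | ⟨i, a, rfl⟩
    · exact ⟨b, one_dvd _, dvd_rfl, fun _ _ h => h⟩
    rcases eq_one_or_eq_sigma_mul b with rfl | ⟨j, b, rfl⟩
    · exact ⟨_, dvd_rfl, one_dvd _, fun _ h _ => h⟩
    have hi : sigma i ∣ m := dvd_of_mul_right_dvd ha
    have hj : sigma j ∣ m := dvd_of_mul_right_dvd hb
    have hij := (isRightLcm_sigma i j).2.2 m hi hj
    have key : ∀ (i : Fin (n - 1)) (x y : BraidMonoid n), sigma i * x ∣ m → sigma i * y ∣ m →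
        ∃ l, IsRightLcm (sigma i * x) (sigma i * y) l := by
      rintro i x y hx hy
      obtain ⟨m', rfl⟩ := dvd_of_mul_right_dvd hx
      obtain ⟨l, hl⟩ := ih (len m') (by rw [← hN]; simp) (dvd_of_mul_dvd_mul hx)
        (dvd_of_mul_dvd_mul hy) rfl
      exact ⟨_, hl.mul_left _⟩
    -- The lcm of `σ_i a` and `σ_j b` is taken in two stages: first absorb the lcm of `σ_i` and
    -- `σ_j` into `σ_i a`. The result `p` starts with `σ_j`, hence can be compared with `σ_j b`.
    obtain ⟨p, hp⟩ := key i a (compl i j) ha hij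
    have hjp : sigma j ∣ p := (isRightLcm_sigma i j).2.1.trans hp.2.1
    have hpm : p ∣ m := hp.2.2 m ha hij
    obtain ⟨p', rfl⟩ := hjp
    obtain ⟨l, hl⟩ := key j p' b hpm hb
    refine ⟨l, hp.1.trans hl.1, hl.2.1, fun m' ha' hb' => hl.2.2 m' ?_ hb'⟩
    exact hp.2.2 m' ha' ((isRightLcm_sigma i j).2.2 m' (dvd_of_mul_right_dvd ha')
      (dvd_of_mul_right_dvd hb'))

/-- A common divisor of maximal length works: its lcm with any other common divisor still divides
both elements, so it cannot be longer. -/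
theorem exists_isLeftGcd (a b : BraidMonoid n) : ∃ g, IsLeftGcd a b g := by
  classical
  obtain ⟨g, hga, hgb, hg⟩ := Nat.findGreatest_spec (P := fun k => ∃ g : BraidMonoid n,
    g ∣ a ∧ g ∣ b ∧ len g = k) (m := 0) (n := len a) (Nat.zero_le _)
    ⟨1, one_dvd _, one_dvd _, len_one⟩
  refine ⟨g, hga, hgb, fun h ha hb => ?_⟩
  obtain ⟨l, hl⟩ := exists_isRightLcm hga ha
  have hla := hl.2.2 a hga ha
  have hlb := hl.2.2 b hgb hb
  have hle := Nat.le_findGreatest (P := fun k => ∃ g : BraidMonoid n,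
    g ∣ a ∧ g ∣ b ∧ len g = k) (len_le_of_dvd hla) ⟨l, hla, hlb, rfl⟩
  rw [← hg] at hle
  obtain ⟨z, rfl⟩ := hl.1
  simp only [len_mul] at hle
  rw [len_eq_zero.1 (by omega : len z = 0), mul_one] at hl
  exact hl.2.1

/-- The local characterisation of the greedy factor. -/
theorem isLeftGcd_delta_iff {x b : BraidMonoid n} :
    IsLeftGcd (Delta n n le_rfl) (x * b) x ↔
      IsSimple x ∧ ∀ i, sigma i ∣ b → ¬ IsSimple (x * sigma i) := by
  constructor
  · rintro ⟨h1, h2, h3⟩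
    refine ⟨h1, fun i hi hs => ?_⟩
    have := len_le_of_dvd (h3 _ hs (mul_dvd_mul_left' x hi))
    simp at this
  · rintro ⟨h1, h2⟩
    obtain ⟨g, hg⟩ := exists_isLeftGcd (Delta n n le_rfl) (x * b)
    obtain ⟨z, rfl⟩ := hg.2.2 x h1 (dvd_mul_right _ _)
    -- If the gcd were strictly larger than `x`, the first generator of the excess would start `b`
    -- and keep `x` simple.
    rcases eq_one_or_eq_sigma_mul z with rfl | ⟨i, z, rfl⟩
    · simpa using hg
    · refine absurd ?_ (h2 i (dvd_of_mul_right_dvd (dvd_of_mul_dvd_mul hg.2.1)))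
      rw [← mul_assoc] at hg
      exact dvd_of_mul_right_dvd hg.1

end BraidMonoid

/-! ### Permutations, inversions and descents. -/

namespace BraidMonoid

variable {n : ℕ}

/-- The left position of the `i`-th adjacent transposition. -/
def lo (i : Fin (n - 1)) : Fin n := ⟨i, by omega⟩

/-- The right position of the `i`-th adjacent transposition. -/
def hi (i : Fin (n - 1)) : Fin n := ⟨i + 1, by omega⟩

@[simp] lemma val_lo (i : Fin (n - 1)) : (lo i : ℕ) = i := rfl
@[simp] lemma val_hi (i : Fin (n - 1)) : (hi i : ℕ) = i + 1 := rfl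

lemma lo_lt_hi (i : Fin (n - 1)) : lo i < hi i := Nat.lt_succ_self _

lemma lo_ne_hi (i : Fin (n - 1)) : lo i ≠ hi i := (lo_lt_hi i).ne

/-- The `i`-th adjacent transposition. -/
def adjSwap (i : Fin (n - 1)) : Equiv.Perm (Fin n) := Equiv.swap (lo i) (hi i)

lemma adjSwap_lo (i : Fin (n - 1)) : adjSwap i (lo i) = hi i := Equiv.swap_apply_left _ _
lemma adjSwap_hi (i : Fin (n - 1)) : adjSwap i (hi i) = lo i := Equiv.swap_apply_right _ _
lemma adjSwap_of_ne {i : Fin (n - 1)} {a : Fin n} (h : (a : ℕ) ≠ i) (h' : (a : ℕ) ≠ i + 1) :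
    adjSwap i a = a :=
  Equiv.swap_apply_of_ne_of_ne (by simpa [Fin.ext_iff]) (by simpa [Fin.ext_iff])

lemma val_adjSwap (i : Fin (n - 1)) (a : Fin n) :
    (adjSwap i a : ℕ) = if (a : ℕ) = i then (i : ℕ) + 1 else if (a : ℕ) = i + 1 then (i : ℕ) else a := by
  split_ifs with h h'
  · rw [show a = lo i from Fin.ext h, adjSwap_lo]; rfl
  · rw [show a = hi i from Fin.ext h', adjSwap_hi]; rfl
  · rw [adjSwap_of_ne h h']

@[simp] lemma adjSwap_mul_self (i : Fin (n - 1)) : adjSwap i * adjSwap i = 1 :=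
  Equiv.swap_mul_self _ _

@[simp] lemma adjSwap_inv (i : Fin (n - 1)) : (adjSwap i)⁻¹ = adjSwap i := Equiv.swap_inv _ _

@[simp] lemma adjSwap_mul_cancel (i : Fin (n - 1)) (w : Equiv.Perm (Fin n)) :
    adjSwap i * (adjSwap i * w) = w := by simp [← mul_assoc]

/-- The permutation of a positive braid. -/
def toPerm : BraidMonoid n →* Equiv.Perm (Fin n) :=
  PresentedMonoid.lift adjSwap (by
    rintro a b (⟨i, j, h⟩ | ⟨i, j, h⟩)
    all_goals
      ext a
      simp only [map_mul, FreeMonoid.lift_eval_of, Equiv.Perm.mul_apply, val_adjSwap]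
      grind)

@[simp] lemma toPerm_sigma (i : Fin (n - 1)) : toPerm (sigma i) = adjSwap i := rfl

/-- The set of inversions of a permutation. -/
def invSet (w : Equiv.Perm (Fin n)) : Finset (Fin n × Fin n) :=
  {p | p.1 < p.2 ∧ w p.2 < w p.1}

/-- The number of inversions of a permutation. -/
def inv (w : Equiv.Perm (Fin n)) : ℕ := (invSet w).card

@[simp] lemma mem_invSet {w : Equiv.Perm (Fin n)} {p : Fin n × Fin n} :
    p ∈ invSet w ↔ p.1 < p.2 ∧ w p.2 < w p.1 := by simp [invSet]

/-- Right descents, that is, descents in the one-line notation. -/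
def RDesc (w : Equiv.Perm (Fin n)) (i : Fin (n - 1)) : Prop := w (hi i) < w (lo i)

/-- Left descents. -/
def LDesc (w : Equiv.Perm (Fin n)) (i : Fin (n - 1)) : Prop := RDesc w⁻¹ i

lemma not_rDesc {w : Equiv.Perm (Fin n)} {i : Fin (n - 1)} :
    ¬ RDesc w i ↔ w (lo i) < w (hi i) := by
  rw [RDesc, not_lt, le_iff_lt_or_eq, or_iff_left (fun h => lo_ne_hi i (w.injective h))]

lemma inv_inv (w : Equiv.Perm (Fin n)) : inv w⁻¹ = inv w := by
  refine Finset.card_bij' (fun p _ => (w⁻¹ p.2, w⁻¹ p.1)) (fun p _ => (w p.2, w p.1)) ?_ ?_ ?_ ?_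
  · rintro ⟨a, b⟩ h; simpa [and_comm] using h
  · rintro ⟨a, b⟩ h; simpa [and_comm] using h
  · simp
  · simp

lemma adjSwap_lt_adjSwap {i : Fin (n - 1)} {a b : Fin n} (h : a < b)
    (h' : ¬ (a = lo i ∧ b = hi i)) : adjSwap i a < adjSwap i b := by
  rw [Fin.lt_def] at h ⊢
  simp only [Fin.ext_iff, val_lo, val_hi] at h'
  simp only [val_adjSwap]
  split_ifs <;> omega

lemma adjSwap_adjSwap (i : Fin (n - 1)) (a : Fin n) : adjSwap i (adjSwap i a) = a :=
  Equiv.swap_apply_self _ _ _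

/-- Swapping two adjacent ascending entries transports the old inversions and creates exactly one
new one, the swapped pair. -/
lemma inv_mul_adjSwap_of_not_rDesc {w : Equiv.Perm (Fin n)} {i : Fin (n - 1)}
    (h : ¬ RDesc w i) : inv (w * adjSwap i) = inv w + 1 := by
  rw [not_rDesc] at h
  have key : invSet (w * adjSwap i) = insert (lo i, hi i)
      ((invSet w).map (Equiv.prodCongr (adjSwap i) (adjSwap i)).toEmbedding) := by
    ext ⟨a, b⟩
    simp only [mem_invSet, Finset.mem_insert, Finset.mem_map_equiv, Prod.mk.injEq,
      Equiv.Perm.mul_apply]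
    have hs : (Equiv.prodCongr (adjSwap i) (adjSwap i)).symm (a, b) =
        (adjSwap i a, adjSwap i b) := by
      simp [adjSwap]
    rw [hs]
    constructor
    · rintro ⟨h1, h2⟩
      by_cases hab : a = lo i ∧ b = hi i
      · exact .inl hab
      · exact .inr ⟨adjSwap_lt_adjSwap h1 hab, h2⟩
    · rintro (⟨rfl, rfl⟩ | ⟨h1, h2⟩)
      · rw [adjSwap_hi, adjSwap_lo]
        exact ⟨lo_lt_hi i, h⟩
      · refine ⟨?_, h2⟩
        have := adjSwap_lt_adjSwap (i := i) h1 ?_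
        · simpa [adjSwap_adjSwap] using this
        · rintro ⟨ha, hb⟩
          simp only at ha hb
          rw [ha, hb] at h2
          exact lt_asymm h h2
  rw [inv, key, Finset.card_insert_of_notMem, Finset.card_map, inv]
  rw [Finset.mem_map_equiv]
  have hs : (Equiv.prodCongr (adjSwap i) (adjSwap i)).symm (lo i, hi i) = (hi i, lo i) := by
    simp [adjSwap]
  rw [hs, mem_invSet]
  exact fun h' => lt_asymm h'.1 (lo_lt_hi i)

lemma rDesc_mul_adjSwap {w : Equiv.Perm (Fin n)} {i : Fin (n - 1)} :
    RDesc (w * adjSwap i) i ↔ ¬ RDesc w i := by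
  rw [not_rDesc, RDesc, Equiv.Perm.mul_apply, Equiv.Perm.mul_apply, adjSwap_lo, adjSwap_hi]

lemma inv_mul_adjSwap_of_rDesc {w : Equiv.Perm (Fin n)} {i : Fin (n - 1)}
    (h : RDesc w i) : inv (w * adjSwap i) + 1 = inv w := by
  rw [← inv_mul_adjSwap_of_not_rDesc (i := i), mul_assoc, adjSwap_mul_self, mul_one]
  rwa [rDesc_mul_adjSwap, not_not]

lemma inv_adjSwap_mul (w : Equiv.Perm (Fin n)) (i : Fin (n - 1)) :
    inv (adjSwap i * w) = inv (w⁻¹ * adjSwap i) := by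
  rw [← inv_inv]; simp

lemma inv_adjSwap_mul_of_not_lDesc {w : Equiv.Perm (Fin n)} {i : Fin (n - 1)}
    (h : ¬ LDesc w i) : inv (adjSwap i * w) = inv w + 1 := by
  rw [inv_adjSwap_mul, inv_mul_adjSwap_of_not_rDesc h, inv_inv]

lemma inv_adjSwap_mul_of_lDesc {w : Equiv.Perm (Fin n)} {i : Fin (n - 1)}
    (h : LDesc w i) : inv (adjSwap i * w) + 1 = inv w := by
  rw [inv_adjSwap_mul, inv_mul_adjSwap_of_rDesc h, inv_inv]

lemma inv_mul_adjSwap_le (w : Equiv.Perm (Fin n)) (i : Fin (n - 1)) :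
    inv (w * adjSwap i) ≤ inv w + 1 := by
  by_cases h : RDesc w i
  · have := inv_mul_adjSwap_of_rDesc h; omega
  · exact (inv_mul_adjSwap_of_not_rDesc h).le

lemma inv_adjSwap_mul_le (w : Equiv.Perm (Fin n)) (i : Fin (n - 1)) :
    inv (adjSwap i * w) ≤ inv w + 1 := by
  rw [inv_adjSwap_mul, ← inv_inv w]
  exact inv_mul_adjSwap_le _ _

lemma inv_mul_toPerm_le (w : Equiv.Perm (Fin n)) (x : BraidMonoid n) :
    inv (w * toPerm x) ≤ inv w + len x := by
  induction x using induction_sigma generalizing w with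
  | one => simp
  | mul i x ih =>
    have h1 := ih (w * adjSwap i)
    have h2 := inv_mul_adjSwap_le w i
    rw [map_mul, toPerm_sigma, ← mul_assoc, len_mul, len_sigma]
    omega

lemma inv_toPerm_mul_le (w : Equiv.Perm (Fin n)) (x : BraidMonoid n) :
    inv (toPerm x * w) ≤ len x + inv w := by
  induction x using induction_sigma with
  | one => simp
  | mul i x ih =>
    have h2 := inv_adjSwap_mul_le (toPerm x * w) i
    rw [map_mul, toPerm_sigma, mul_assoc, len_mul, len_sigma]
    omega

lemma inv_one : inv (1 : Equiv.Perm (Fin n)) = 0 := by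
  rw [inv, Finset.card_eq_zero, Finset.eq_empty_iff_forall_notMem]
  rintro ⟨a, b⟩ h
  simp only [mem_invSet, Equiv.Perm.coe_one, id] at h
  exact lt_asymm h.1 h.2

lemma strictMono_of_lo_lt_hi {α : Type*} [Preorder α] {f : Fin n → α}
    (h : ∀ i : Fin (n - 1), f (lo i) < f (hi i)) : StrictMono f := by
  cases n with
  | zero => exact fun a => a.elim0
  | succ m => exact Fin.strictMono_iff_lt_succ.2 fun i => h i

lemma eq_one_of_strictMono {w : Equiv.Perm (Fin n)} (h : StrictMono w) : w = 1 := by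
  have := (StrictMono.range_inj h (strictMono_id (α := Fin n))).1 (by simp)
  exact Equiv.ext fun a => congrFun this a

lemma exists_lDesc {w : Equiv.Perm (Fin n)} (h : w ≠ 1) : ∃ i, LDesc w i := by
  by_contra! hc
  exact h (inv_eq_one.1 (eq_one_of_strictMono
    (strictMono_of_lo_lt_hi fun i => not_rDesc.1 (hc i))))

lemma exists_not_rDesc {w : Equiv.Perm (Fin n)} (h : w ≠ Fin.revPerm) : ∃ i, ¬ RDesc w i := by
  by_contra! hc
  have : Fin.revPerm * w = 1 := eq_one_of_strictMono
    (strictMono_of_lo_lt_hi fun i => Fin.rev_lt_rev.2 (hc i))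
  apply h
  rw [← inv_eq_of_mul_eq_one_right this]
  rfl

/-! ### Reduced braids are the simple braids. -/

/-- A braid is reduced if its length is the number of inversions of its permutation. -/
def Reduced (x : BraidMonoid n) : Prop := inv (toPerm x) = len x

lemma reduced_iff {x : BraidMonoid n} : Reduced x ↔ len x ≤ inv (toPerm x) := by
  refine ⟨fun h => h.ge, fun h => le_antisymm ?_ h⟩
  simpa [inv_one] using inv_mul_toPerm_le 1 x

/-- Each generator adds at most one inversion, so a product reaches the maximum only if both factors
do. -/
lemma Reduced.of_mul {x y : BraidMonoid n} (h : Reduced (x * y)) : Reduced x ∧ Reduced y := by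
  have h1 := inv_mul_toPerm_le (toPerm x) y
  have h2 := inv_toPerm_mul_le (toPerm y) x
  rw [Reduced, map_mul, len_mul] at h
  rw [reduced_iff, reduced_iff]
  omega

lemma reduced_one : Reduced (1 : BraidMonoid n) := by simp [Reduced, inv_one]

lemma reduced_sigma_mul {x : BraidMonoid n} {i : Fin (n - 1)} :
    Reduced (sigma i * x) ↔ Reduced x ∧ ¬ LDesc (toPerm x) i := by
  constructor
  · intro h
    refine ⟨h.of_mul.2, fun hd => ?_⟩
    have h1 := inv_adjSwap_mul_of_lDesc hd
    have h2 := h.of_mul.2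
    simp only [Reduced, map_mul, len_mul, toPerm_sigma, len_sigma] at h h2
    omega
  · rintro ⟨h, hd⟩
    have h1 := inv_adjSwap_mul_of_not_lDesc hd
    simp only [Reduced, map_mul, len_mul, toPerm_sigma, len_sigma] at h ⊢
    omega

lemma reduced_mul_sigma {x : BraidMonoid n} {i : Fin (n - 1)} :
    Reduced (x * sigma i) ↔ Reduced x ∧ ¬ RDesc (toPerm x) i := by
  constructor
  · intro h
    refine ⟨h.of_mul.1, fun hd => ?_⟩
    have h1 := inv_mul_adjSwap_of_rDesc hd
    have h2 := h.of_mul.1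
    simp only [Reduced, map_mul, len_mul, toPerm_sigma, len_sigma] at h h2
    omega
  · rintro ⟨h, hd⟩
    have h1 := inv_mul_adjSwap_of_not_rDesc hd
    simp only [Reduced, map_mul, len_mul, toPerm_sigma, len_sigma] at h ⊢
    omega

lemma reduced_sigma (i : Fin (n - 1)) : Reduced (sigma i : BraidMonoid n) := by
  rw [← mul_one (sigma i), reduced_sigma_mul]
  refine ⟨reduced_one, ?_⟩
  simpa [LDesc, RDesc] using (lo_lt_hi i).le

lemma lDesc_adjSwap_mul {w : Equiv.Perm (Fin n)} {i : Fin (n - 1)} :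
    LDesc (adjSwap i * w) i ↔ ¬ LDesc w i := by
  rw [LDesc, mul_inv_rev, adjSwap_inv, rDesc_mul_adjSwap, LDesc]

theorem exists_reduced (w : Equiv.Perm (Fin n)) : ∃ x, Reduced x ∧ toPerm x = w := by
  induction h : inv w generalizing w with
  | zero =>
    by_cases hw : w = 1
    · exact ⟨1, reduced_one, by simp [hw]⟩
    · obtain ⟨i, hi⟩ := exists_lDesc hw
      have := inv_adjSwap_mul_of_lDesc hi
      omega
  | succ m ih =>
    by_cases hw : w = 1
    · exact ⟨1, reduced_one, by simp [hw]⟩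
    · obtain ⟨i, hi⟩ := exists_lDesc hw
      have := inv_adjSwap_mul_of_lDesc hi
      obtain ⟨x, hx, hxw⟩ := ih (adjSwap i * w) (by omega)
      refine ⟨sigma i * x, ?_, by simp [hxw]⟩
      rw [reduced_sigma_mul, hxw, lDesc_adjSwap_mul, not_not]
      exact ⟨hx, hi⟩

lemma exists_reduced_sigma_mul {w : Equiv.Perm (Fin n)} {i : Fin (n - 1)} (h : LDesc w i) :
    ∃ x, Reduced (sigma i * x) ∧ toPerm (sigma i * x) = w := by
  obtain ⟨x, hx, hxw⟩ := exists_reduced (adjSwap i * w)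
  refine ⟨x, ?_, by simp [hxw]⟩
  rw [reduced_sigma_mul, hxw, lDesc_adjSwap_mul, not_not]
  exact ⟨hx, h⟩

/-- Two left descents can be split off together, as the lcm of the two generators. When they are
adjacent, three positions in `w⁻¹` are decreasing, which allows three successive reducing swaps. -/
lemma exists_reduced_lcm {w : Equiv.Perm (Fin n)} {i j : Fin (n - 1)} (hi : LDesc w i)
    (hj : LDesc w j) :
    ∃ z, Reduced (sigma i * (compl i j * z)) ∧ toPerm (sigma i * (compl i j * z)) = w := by
  rcases eq_or_far_or_adj i j with rfl | hij | hij
  · simpa using exists_reduced_sigma_mul hi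
  · have h2 : LDesc (adjSwap i * w) j := by
      simp only [LDesc, RDesc, mul_inv_rev, adjSwap_inv, Equiv.Perm.mul_apply] at hj ⊢
      unfold Far at hij
      rwa [adjSwap_of_ne (by simp; omega) (by simp; omega),
        adjSwap_of_ne (by simp; omega) (by simp; omega)]
    obtain ⟨z, hz, hzw⟩ := exists_reduced_sigma_mul h2
    refine ⟨z, ?_, by simp [hij.compl, hzw, map_mul (toPerm (n := n)) (sigma i)]⟩
    rw [hij.compl, reduced_sigma_mul, hzw, lDesc_adjSwap_mul, not_not]
    exact ⟨hz, hi⟩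
  · have key : LDesc (adjSwap i * w) j ∧ LDesc (adjSwap j * (adjSwap i * w)) i := by
      simp only [LDesc, RDesc, mul_inv_rev, adjSwap_inv, Equiv.Perm.mul_apply] at hi hj ⊢
      rcases hij with hij | hij
      · have e : lo j = BraidMonoid.hi i := by ext; simp; omega
        have e1 : adjSwap i (BraidMonoid.hi j) = BraidMonoid.hi j :=
          adjSwap_of_ne (by simp; omega) (by simp; omega)
        have e2 : adjSwap j (lo i) = lo i := adjSwap_of_ne (by simp; omega) (by simp; omega)
        have e3 : adjSwap j (BraidMonoid.hi i) = BraidMonoid.hi j := by rw [← e, adjSwap_lo]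
        rw [e] at hj
        rw [e2, e3, e1, e, adjSwap_hi, adjSwap_lo]
        exact ⟨hj.trans hi, hj⟩
      · have e : BraidMonoid.hi j = lo i := by ext; simp; omega
        have e1 : adjSwap i (lo j) = lo j := adjSwap_of_ne (by simp; omega) (by simp; omega)
        have e2 : adjSwap j (BraidMonoid.hi i) = BraidMonoid.hi i :=
          adjSwap_of_ne (by simp; omega) (by simp; omega)
        have e3 : adjSwap j (lo i) = lo j := by rw [← e, adjSwap_hi]
        rw [e] at hj
        rw [e2, e3, e1, e, adjSwap_hi, adjSwap_lo]
        exact ⟨hi.trans hj, hj⟩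
    obtain ⟨z, hz, hzw⟩ := exists_reduced_sigma_mul key.2
    have hz' : Reduced (sigma j * (sigma i * z)) := by
      rw [reduced_sigma_mul, hzw, lDesc_adjSwap_mul, not_not]
      exact ⟨hz, key.1⟩
    have hzw' : toPerm (sigma j * (sigma i * z)) = adjSwap i * w := by
      rw [map_mul, hzw, toPerm_sigma, adjSwap_mul_cancel]
    refine ⟨z, ?_, ?_⟩
    · rw [hij.compl, mul_assoc, reduced_sigma_mul, hzw', lDesc_adjSwap_mul, not_not]
      exact ⟨hz', hi⟩
    · rw [hij.compl, mul_assoc, map_mul, hzw', toPerm_sigma, adjSwap_mul_cancel]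

/-- Matsumoto's theorem. Both first generators are left descents of the common permutation, so some
reduced braid for it starts with their lcm. It shares a first generator with each of `x` and `y`,
hence equals each by induction. -/
theorem Reduced.ext {x y : BraidMonoid n} (hx : Reduced x) (hy : Reduced y)
    (h : toPerm x = toPerm y) : x = y := by
  have hl : len x = len y := by rw [← hx, ← hy, h]
  induction hm : len x generalizing x y with
  | zero => rw [len_eq_zero.1 hm, len_eq_zero.1 (hl.symm.trans hm)]
  | succ m ih =>
    rcases eq_one_or_eq_sigma_mul x with rfl | ⟨i, x, rfl⟩
    · simp at hm
    rcases eq_one_or_eq_sigma_mul y with rfl | ⟨j, y, rfl⟩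
    · simp at hl
    have hi : LDesc (toPerm (sigma i * x)) i := by
      rw [map_mul, toPerm_sigma, lDesc_adjSwap_mul]; exact (reduced_sigma_mul.1 hx).2
    have hj : LDesc (toPerm (sigma i * x)) j := by
      rw [h, map_mul, toPerm_sigma, lDesc_adjSwap_mul]; exact (reduced_sigma_mul.1 hy).2
    obtain ⟨z, hz, hzw⟩ := exists_reduced_lcm hi hj
    have e : sigma i * (compl i j * z) = sigma j * (compl j i * z) := by
      rw [← mul_assoc, sigma_mul_compl, mul_assoc]
    have hcancel : ∀ {k : Fin (n - 1)} {a b : BraidMonoid n}, Reduced (sigma k * a) →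
        Reduced (sigma k * b) → toPerm (sigma k * a) = toPerm (sigma k * b) →
        len (sigma k * a) = m + 1 → a = b := by
      intro k a b ha hb hab hla
      have hab' : toPerm a = toPerm b := by simpa using hab
      have hlab : len a = len b := by rw [← ha.of_mul.2, ← hb.of_mul.2, hab']
      exact ih ha.of_mul.2 hb.of_mul.2 hab' hlab (by simp at hla; omega)
    rw [hcancel hx hz hzw.symm hm, hcancel hy (e ▸ hz) (h.symm.trans (hzw.symm.trans (by rw [e])))
      (hl ▸ hm), e]

lemma inv_revPerm : inv (Fin.revPerm : Equiv.Perm (Fin n)) = ∑ i ∈ Finset.range n, i := by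
  have : ∀ w : Equiv.Perm (Fin n), invSet w =
      (Finset.univ : Finset (Fin n × Fin n)).filter (fun p => p.1 < p.2 ∧ w p.2 < w p.1) :=
    fun _ => rfl
  rw [inv, this, Finset.card_filter, ← Finset.univ_product_univ, Finset.sum_product_right,
    ← Fin.sum_univ_eq_sum_range (fun i => i)]
  refine Finset.sum_congr rfl fun b _ => ?_
  rw [← Finset.card_filter]
  have : ({a | (a, b).1 < (a, b).2 ∧ Fin.revPerm (a, b).2 < Fin.revPerm (a, b).1} :
      Finset (Fin n)) = Finset.Iio b := by
    ext a; simp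
  rw [this, Fin.card_Iio]

lemma len_delta (r : ℕ) (h : r ≤ n) : len (Delta n r h) = ∑ i ∈ Finset.range r, i := by
  induction r with
  | zero => simp [Delta]
  | succ r ih =>
    rw [Delta, len_mul, ih, Finset.sum_range_succ, add_comm]
    congr 1
    have : ∀ L : List (Fin (n - 1)), len (L.map sigma : List (BraidMonoid n)).prod = L.length := by
      intro L
      induction L with
      | nil => simp
      | cons a L ih => simp [ih, add_comm]
    have h2 := this (List.ofFn fun i : Fin r => (⟨i, by omega⟩ : Fin (n - 1)))
    rw [List.map_ofFn, List.length_ofFn] at h2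
    exact h2

lemma toPerm_prod_ofFn (r : ℕ) (h : r + 1 ≤ n) (a : Fin n) :
    (toPerm (List.ofFn fun i : Fin r => sigma (⟨i, by omega⟩ : Fin (n - 1))).prod a : ℕ) =
      if (a : ℕ) < r then (a : ℕ) + 1 else if (a : ℕ) = r then 0 else a := by
  induction r generalizing a with
  | zero => simp
  | succ r ih =>
    rw [List.ofFn_succ', List.prod_concat, map_mul, Equiv.Perm.mul_apply]
    simp only [Fin.val_castSucc]
    rw [ih (by omega), toPerm_sigma]
    simp only [val_adjSwap, Fin.val_last]
    clear ih
    split_ifs <;> omega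

lemma toPerm_delta (r : ℕ) (h : r ≤ n) (a : Fin n) :
    (toPerm (Delta n r h) a : ℕ) = if (a : ℕ) < r then r - 1 - (a : ℕ) else a := by
  induction r with
  | zero => simp [Delta]
  | succ r ih =>
    rw [Delta, map_mul, Equiv.Perm.mul_apply, toPerm_prod_ofFn r h, ih]
    clear ih
    split_ifs <;> omega

lemma toPerm_delta_self : toPerm (Delta n n le_rfl) = Fin.revPerm := by
  ext a
  rw [toPerm_delta]
  simp
  omega

lemma reduced_delta_self : Reduced (Delta n n le_rfl) := by
  rw [Reduced, toPerm_delta_self, inv_revPerm, len_delta]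

/-- `Δ_n` is reduced and divisors inherit this. Conversely, a reduced braid can be prolonged at
ascents, staying reduced, until its permutation is the reversal; by `Reduced.ext` it is then `Δ_n`.
The bound on the number of inversions makes this terminate. -/
theorem isSimple_iff_reduced {x : BraidMonoid n} : IsSimple x ↔ Reduced x := by
  constructor
  · rintro ⟨z, hz⟩
    exact (hz ▸ reduced_delta_self : Reduced (x * z)).of_mul.1
  · intro hx
    have hb : ∀ y : BraidMonoid n, Reduced y → len y ≤ Fintype.card (Fin n × Fin n) :=
      fun y hy => hy ▸ Finset.card_le_univ _
    induction hm : Fintype.card (Fin n × Fin n) - len x generalizing x with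
    | zero =>
      by_cases hw : toPerm x = Fin.revPerm
      · rw [hx.ext reduced_delta_self (hw.trans toPerm_delta_self.symm)]
        exact dvd_rfl
      · obtain ⟨i, hi⟩ := exists_not_rDesc hw
        have := hb _ (reduced_mul_sigma.2 ⟨hx, hi⟩)
        simp only [len_mul, len_sigma] at this
        omega
    | succ m ih =>
      by_cases hw : toPerm x = Fin.revPerm
      · rw [hx.ext reduced_delta_self (hw.trans toPerm_delta_self.symm)]
        exact dvd_rfl
      · obtain ⟨i, hi⟩ := exists_not_rDesc hw
        refine dvd_of_mul_right_dvd (ih (reduced_mul_sigma.2 ⟨hx, hi⟩) ?_)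
        simp only [len_mul, len_sigma]
        omega

/-- `Δ_r` is by construction a right factor of `Δ_n`, while simplicity asks for a left factor;
reducedness does not distinguish the two sides. -/
lemma isSimple_delta (r : ℕ) (h : r ≤ n) : IsSimple (Delta n r h) := by
  rw [isSimple_iff_reduced]
  suffices ∀ (m : ℕ) (hm : r ≤ m) (hmk : m ≤ n), Reduced (Delta n m hmk) →
      Reduced (Delta n r (hm.trans hmk)) from
    this n h le_rfl reduced_delta_self
  intro m hm hmk h
  induction m, hm using Nat.le_induction with
  | base => exact h
  | succ m hm ih => exact ih (by omega) h.of_mul.2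

lemma IsSimple.sigma_dvd_iff {x : BraidMonoid n} (hx : IsSimple x) {i : Fin (n - 1)} :
    sigma i ∣ x ↔ LDesc (toPerm x) i := by
  rw [isSimple_iff_reduced] at hx
  constructor
  · rintro ⟨y, rfl⟩
    rw [map_mul, toPerm_sigma, lDesc_adjSwap_mul]
    exact (reduced_sigma_mul.1 hx).2
  · intro h
    obtain ⟨y, hy, hyx⟩ := exists_reduced_sigma_mul h
    exact ⟨y, hx.ext hy hyx.symm⟩

lemma IsSimple.mul_sigma_iff {x : BraidMonoid n} (hx : IsSimple x) {i : Fin (n - 1)} :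
    IsSimple (x * sigma i) ↔ ¬ RDesc (toPerm x) i := by
  rw [isSimple_iff_reduced] at hx ⊢
  rw [reduced_mul_sigma, and_iff_right hx]

lemma IsNormal.sigma_dvd_iff {x : BraidMonoid n} {L : List (BraidMonoid n)}
    (h : IsNormal (x :: L)) {i : Fin (n - 1)} :
    sigma i ∣ (x :: L).prod ↔ LDesc (toPerm x) i := by
  rw [← h.1.sigma_dvd_iff, List.prod_cons]
  exact ⟨fun hi => h.2.1.2.2 _ (isSimple_iff_reduced.2 (reduced_sigma i)) hi,
    fun hi => hi.trans (dvd_mul_right _ _)⟩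

/-! ### Normal sequences in terms of descents. -/

/-- Permutations of consecutive factors of a normal sequence. -/
def Follows (v w : Equiv.Perm (Fin n)) : Prop := ∀ i, LDesc w i → RDesc v i

lemma isNormal_singleton {x : BraidMonoid n} : IsNormal [x] ↔ IsSimple x := by
  refine ⟨fun h => h.1, fun h => ⟨h, ?_, trivial⟩⟩
  simp only [List.prod_nil, mul_one]
  exact ⟨h, dvd_rfl, fun _ _ h => h⟩

/-- Greediness at `x` only involves the generators starting the rest. As the rest is normal, these
already divide `y`, so the condition is local. -/
lemma isNormal_cons_cons {x y : BraidMonoid n} {L : List (BraidMonoid n)} :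
    IsNormal (x :: y :: L) ↔
      IsSimple x ∧ Follows (toPerm x) (toPerm y) ∧ IsNormal (y :: L) := by
  rw [IsNormal]
  refine and_congr_right fun hx => and_congr_left fun h => ?_
  rw [isLeftGcd_delta_iff, and_iff_right hx]
  refine forall_congr' fun i => ?_
  rw [h.sigma_dvd_iff, hx.mul_sigma_iff, not_not]

end BraidMonoid

/-! ### Uniqueness of normal forms and the count by permutations. -/

namespace BraidMonoid

variable {n : ℕ}

theorem IsNormal.eq_of_prod_eq {L L' : List (BraidMonoid n)} (h : IsNormal L) (h' : IsNormal L')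
    (hl : L.length = L'.length) (hp : L.prod = L'.prod) : L = L' := by
  induction L generalizing L' with
  | nil => exact (List.length_eq_zero_iff.1 hl.symm).symm
  | cons x L ih =>
    cases L' with
    | nil => simp at hl
    | cons y L' =>
      rw [List.prod_cons, List.prod_cons] at hp
      have hx := h.2.1
      have hy := h'.2.1
      rw [hp] at hx
      obtain rfl : x = y := dvd_antisymm' (hy.2.2 x hx.1 hx.2.1) (hx.2.2 y hy.1 hy.2.1)
      rw [ih h.2.2 h'.2.2 (by simpa using hl) (mul_left_cancel' hp)]

lemma isNormal_append_one {L : List (BraidMonoid n)} : IsNormal (L ++ [1]) ↔ IsNormal L := by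
  induction L with
  | nil => exact ⟨fun _ => trivial, fun _ => isNormal_singleton.2 (one_dvd _)⟩
  | cons x L ih =>
    rw [List.cons_append, IsNormal, IsNormal, ih]
    simp

/-- The first `m` terms of `s` form a normal sequence with product `x`. -/
def IsNormalUpTo (x : BraidMonoid n) (s : ℕ → BraidMonoid n) (m : ℕ) : Prop :=
  IsNormal ((List.range m).map s) ∧ ((List.range m).map s).prod = x

lemma isNormalUpTo_add {x : BraidMonoid n} {s : ℕ → BraidMonoid n} {m : ℕ}
    (h : ∀ k, m ≤ k → s k = 1) (k : ℕ) : IsNormalUpTo x s (m + k) ↔ IsNormalUpTo x s m := by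
  induction k with
  | zero => rfl
  | succ k ih =>
    rw [← ih, ← add_assoc, IsNormalUpTo, IsNormalUpTo, List.range_succ, List.map_append,
      List.map_singleton, h _ (Nat.le_add_right m k), isNormal_append_one, List.prod_append]
    simp

lemma IsNormalForm.isNormalUpTo {x : BraidMonoid n} {s : ℕ → BraidMonoid n}
    (h : IsNormalForm x s) {d : ℕ} (hd : ∀ k, d ≤ k → s k = 1) : IsNormalUpTo x s d := by
  obtain ⟨N, h1, h2, h3⟩ := h
  rw [← isNormalUpTo_add hd N, add_comm, isNormalUpTo_add h3 d]
  exact ⟨h1, h2⟩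

theorem IsNormalForm.unique {x : BraidMonoid n} {s t : ℕ → BraidMonoid n}
    (hs : IsNormalForm x s) (ht : IsNormalForm x t) : s = t := by
  obtain ⟨N, h1, h2, h3⟩ := hs
  obtain ⟨M, h1', h2', h3'⟩ := ht
  funext k
  -- Both sequences are padded with trivial factors to the common length `N + M + k + 1`, which
  -- exceeds `k`.
  have hs := (isNormalUpTo_add h3 (M + k + 1)).2 ⟨h1, h2⟩
  have ht := (isNormalUpTo_add h3' (N + k + 1)).2 ⟨h1', h2'⟩
  rw [show M + (N + k + 1) = N + (M + k + 1) by omega] at ht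
  have := hs.1.eq_of_prod_eq ht.1 (by simp) (hs.2.trans ht.2.symm)
  exact List.map_inj_left.1 this k (List.mem_range.2 (by omega))

/-- Braids of degree at most `4` with last factor `y` are products of normal sequences
ending with `y`. -/
lemma degreeLE_and_isFactor_iff {x y : BraidMonoid n} :
    DegreeLE x 4 ∧ IsFactor x 4 y ↔
      ∃ a b c, IsNormal [a, b, c, y] ∧ [a, b, c, y].prod = x := by
  constructor
  · rintro ⟨⟨s, hs, h1⟩, ⟨t, ht, rfl⟩⟩
    obtain rfl := hs.unique ht
    exact ⟨s 0, s 1, s 2, hs.isNormalUpTo h1⟩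
  · rintro ⟨a, b, c, h1, h2⟩
    set s : ℕ → BraidMonoid n := fun k => [a, b, c, y].getD k 1 with hs
    have hs1 : ∀ k, 4 ≤ k → s k = 1 := fun k hk => List.getD_eq_default _ _ (by simpa using hk)
    have hsn : IsNormalForm x s := ⟨4, h1, h2, hs1⟩
    exact ⟨⟨s, hsn, hs1⟩, ⟨s, hsn, rfl⟩⟩

/-- The simple braid of a permutation. -/
noncomputable def ofPerm (w : Equiv.Perm (Fin n)) : BraidMonoid n := (exists_reduced w).choose

@[simp] lemma toPerm_ofPerm (w : Equiv.Perm (Fin n)) : toPerm (ofPerm w) = w :=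
  (exists_reduced w).choose_spec.2

lemma isSimple_ofPerm (w : Equiv.Perm (Fin n)) : IsSimple (ofPerm w) :=
  isSimple_iff_reduced.2 (exists_reduced w).choose_spec.1

lemma IsSimple.ofPerm_toPerm {x : BraidMonoid n} (hx : IsSimple x) : ofPerm (toPerm x) = x :=
  (isSimple_iff_reduced.1 (isSimple_ofPerm _)).ext (isSimple_iff_reduced.1 hx) (toPerm_ofPerm _)

lemma isNormal_quadruple {a b c y : BraidMonoid n} :
    IsNormal [a, b, c, y] ↔ (IsSimple a ∧ IsSimple b ∧ IsSimple c ∧ IsSimple y) ∧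
      Follows (toPerm a) (toPerm b) ∧ Follows (toPerm b) (toPerm c) ∧
      Follows (toPerm c) (toPerm y) := by
  rw [isNormal_cons_cons, isNormal_cons_cons, isNormal_cons_cons, isNormal_singleton]
  tauto

theorem numBraids_four {y : BraidMonoid n} (hy : IsSimple y) :
    numBraids n 4 y = Nat.card {t : Equiv.Perm (Fin n) × Equiv.Perm (Fin n) × Equiv.Perm (Fin n) //
      Follows t.1 t.2.1 ∧ Follows t.2.1 t.2.2 ∧ Follows t.2.2 (toPerm y)} := by
  have hn : ∀ t : {t : Equiv.Perm (Fin n) × Equiv.Perm (Fin n) × Equiv.Perm (Fin n) //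
      Follows t.1 t.2.1 ∧ Follows t.2.1 t.2.2 ∧ Follows t.2.2 (toPerm y)},
      IsNormal [ofPerm t.1.1, ofPerm t.1.2.1, ofPerm t.1.2.2, y] := by
    rintro ⟨t, ht⟩
    rw [isNormal_quadruple]
    exact ⟨⟨isSimple_ofPerm _, isSimple_ofPerm _, isSimple_ofPerm _, hy⟩, by simpa using ht⟩
  refine (Nat.card_congr (Equiv.ofBijective (fun t =>
    ⟨[ofPerm t.1.1, ofPerm t.1.2.1, ofPerm t.1.2.2, y].prod,
      degreeLE_and_isFactor_iff.2 ⟨_, _, _, hn t, rfl⟩⟩) ⟨?_, ?_⟩)).symm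
  · intro t t' h
    have h' := (hn t).eq_of_prod_eq (hn t') rfl (congrArg Subtype.val h)
    simp only [List.cons.injEq, and_true] at h'
    have e : ∀ {v w : Equiv.Perm (Fin n)}, ofPerm v = ofPerm w → v = w := fun {v w} hvw => by
      rw [← toPerm_ofPerm v, hvw, toPerm_ofPerm]
    exact Subtype.ext (Prod.ext (e h'.1) (Prod.ext (e h'.2.1) (e h'.2.2)))
  · rintro ⟨x, hx⟩
    obtain ⟨a, b, c, h1, rfl⟩ := degreeLE_and_isFactor_iff.1 hx
    obtain ⟨⟨ha, hb, hc, -⟩, hf⟩ := isNormal_quadruple.1 h1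
    refine ⟨⟨(toPerm a, toPerm b, toPerm c), hf⟩, Subtype.ext ?_⟩
    simp only [ha.ofPerm_toPerm, hb.ofPerm_toPerm, hc.ofPerm_toPerm]

/-- The permutation of `Δ_{n-1}` is the involution reversing the first `n - 1` points and fixing the
last. -/
lemma lDesc_toPerm_delta_pred {i : Fin (n - 1)} :
    LDesc (toPerm (Delta n (n - 1) (Nat.sub_le n 1))) i ↔ (i : ℕ) + 1 ≠ n - 1 := by
  set w := toPerm (Delta n (n - 1) (Nat.sub_le n 1)) with hw
  have hinv : w⁻¹ = w := by
    rw [inv_eq_iff_mul_eq_one]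
    ext a
    simp only [hw, Equiv.Perm.mul_apply, toPerm_delta, Equiv.Perm.one_apply]
    split_ifs <;> omega
  rw [LDesc, hinv, RDesc, Fin.lt_def, hw, toPerm_delta, toPerm_delta, val_lo, val_hi]
  split_ifs <;> omega

end BraidMonoid

/-! ### Replacing permutations by subsets. -/

namespace BraidMonoid

variable {n : ℕ}

lemma eq_of_lt_iff_lt {u v : Equiv.Perm (Fin n)} (h : ∀ x y, u x < u y ↔ v x < v y) : u = v := by
  have : u * v⁻¹ = 1 := eq_one_of_strictMono fun a b hab => by
    rw [Equiv.Perm.mul_apply, Equiv.Perm.mul_apply, h]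
    simpa using hab
  exact mul_inv_eq_one.1 this

lemma exists_perm_lt_iff {f : Fin n → ℤ} (hf : Function.Injective f) :
    ∃ v : Equiv.Perm (Fin n), ∀ x y, v x < v y ↔ f x < f y := by
  have hlt : ∀ x, (Finset.univ.filter fun z => f z < f x).card < n := fun x => by
    have := Finset.card_lt_univ_of_notMem (s := Finset.univ.filter fun z => f z < f x) (x := x)
      (by simp)
    simpa using this
  have hmono : ∀ x y, f x < f y →
      (Finset.univ.filter fun z => f z < f x).card <
        (Finset.univ.filter fun z => f z < f y).card := fun x y hxy => by
    refine Finset.card_lt_card (Finset.ssubset_iff_of_subset ?_ |>.2 ⟨x, ?_, ?_⟩)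
    · intro z hz
      simp only [Finset.mem_filter, Finset.mem_univ, true_and] at hz ⊢
      exact hz.trans hxy
    · simpa using hxy
    · simp
  let r : Fin n → Fin n := fun x => ⟨_, hlt x⟩
  have hr : ∀ x y, r x < r y ↔ f x < f y := by
    intro x y
    refine ⟨fun h => ?_, fun h => hmono x y h⟩
    by_contra! hc
    rcases hc.lt_or_eq with hc | hc
    · exact lt_asymm h (hmono y x hc)
    · obtain rfl := hf hc
      exact lt_irrefl _ h
  have hinj : Function.Injective r := fun x y hxy => by
    by_contra hne
    rcases lt_or_gt_of_ne (hf.ne hne) with h | h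
    · exact ((hr x y).2 h).ne hxy
    · exact ((hr y x).2 h).ne hxy.symm
  exact ⟨Equiv.ofBijective r (Finite.injective_iff_bijective.1 hinj), hr⟩

/-- All elements of `D` are descents of `w`. -/
def HasDesc (D : Fin (n - 1) → Prop) (w : Equiv.Perm (Fin n)) : Prop := ∀ i, D i → RDesc w i

lemma follows_eq (v w : Equiv.Perm (Fin n)) : Follows v w = HasDesc (LDesc w) v := rfl

/-- The permutation `w` descends at every position, except possibly between the `j`-th
and the next one. -/
def DescOff (j : ℕ) (w : Equiv.Perm (Fin n)) : Prop :=
  HasDesc (fun i => (i : ℕ) + 1 ≠ j) w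

/-- The positions that do not leave the set `A`. -/
def NotLeaving (A : Finset (Fin n)) (i : Fin (n - 1)) : Prop := ¬ (lo i ∈ A ∧ hi i ∉ A)

/-- The order of values in `w`, when `w` consists of the elements of `A` in decreasing order,
followed by the other elements in decreasing order. -/
def Sorts (A : Finset (Fin n)) (w : Equiv.Perm (Fin n)) : Prop :=
  ∀ x y, w⁻¹ x < w⁻¹ y ↔ (x ∈ A ∧ y ∉ A) ∨ ((x ∈ A ↔ y ∈ A) ∧ y < x)

lemma exists_sorts (A : Finset (Fin n)) : ∃ w, Sorts A w := by
  classical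
  -- Negation makes the order decreasing; the shift by `n` puts all of `A` before its complement.
  let f : Fin n → ℤ := fun x => if x ∈ A then -(x : ℤ) - n else -x
  have hf : Function.Injective f := by
    intro x y h
    simp only [f] at h
    ext
    split_ifs at h <;> omega
  obtain ⟨v, hv⟩ := exists_perm_lt_iff hf
  refine ⟨v⁻¹, fun x y => ?_⟩
  rw [_root_.inv_inv, hv, Fin.lt_def]
  simp only [f]
  by_cases hx : x ∈ A <;> by_cases hy : y ∈ A <;> simp [hx, hy] <;> omega

lemma card_filter_perm_lt (v : Equiv.Perm (Fin n)) {j : ℕ} (hj : j ≤ n) :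
    (Finset.univ.filter fun x => (v x : ℕ) < j).card = j := by
  have : (Finset.univ.filter fun x => (v x : ℕ) < j).map v.toEmbedding =
      Finset.univ.filter fun x : Fin n => (x : ℕ) < j := by
    ext x
    simp [Finset.mem_map_equiv]
  rw [← Finset.card_map v.toEmbedding, this, Fin.card_filter_val_lt, min_eq_right hj]

lemma Sorts.eq {A : Finset (Fin n)} {w w' : Equiv.Perm (Fin n)} (h : Sorts A w)
    (h' : Sorts A w') : w = w' :=
  inv_injective (eq_of_lt_iff_lt fun x y => (h x y).trans (h' x y).symm)

lemma Sorts.eq_of_card_eq {A B : Finset (Fin n)} {w : Equiv.Perm (Fin n)} (h : Sorts A w)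
    (h' : Sorts B w) (hc : A.card = B.card) : A = B := by
  by_contra hne
  obtain ⟨x, hxA, hxB⟩ := Finset.not_subset.1
    fun hs => hne (Finset.eq_of_subset_of_card_le hs hc.ge)
  obtain ⟨y, hyB, hyA⟩ := Finset.not_subset.1
    fun hs => hne (Finset.eq_of_subset_of_card_le hs hc.le).symm
  exact lt_asymm ((h x y).2 (.inl ⟨hxA, hyA⟩)) ((h' y x).2 (.inl ⟨hyB, hxB⟩))

lemma Sorts.descOff {A : Finset (Fin n)} {w : Equiv.Perm (Fin n)} (h : Sorts A w) :
    DescOff A.card w := by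
  intro i hi'
  have hlt := lo_lt_hi i
  have h1 := (h (w (lo i)) (w (hi i))).1 (by simpa using hlt)
  rcases h1 with ⟨hx, hy⟩ | ⟨-, h1⟩
  · refine absurd ?_ hi'
    -- A passage from `A` to its complement at position `i` forces `A` to fill the first `i + 1`
    -- places.
    have : A = Finset.univ.filter fun z => (w⁻¹ z : ℕ) < (i : ℕ) + 1 := by
      ext z
      simp only [Finset.mem_filter, Finset.mem_univ, true_and]
      constructor
      · intro hz
        have := (h z (w (hi i))).2 (.inl ⟨hz, hy⟩)
        simpa [Fin.lt_def] using this
      · intro hz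
        by_contra hzA
        have := (h (w (lo i)) z).2 (.inl ⟨hx, hzA⟩)
        rw [show w⁻¹ (w (lo i)) = lo i from w.symm_apply_apply _, Fin.lt_def, val_lo] at this
        omega
    rw [this, card_filter_perm_lt _ (by omega)]
  · exact h1

lemma Sorts.lDesc_iff {A : Finset (Fin n)} {w : Equiv.Perm (Fin n)} (h : Sorts A w)
    (i : Fin (n - 1)) : LDesc w i ↔ NotLeaving A i := by
  have hlt := lo_lt_hi i
  rw [← not_iff_not, NotLeaving, not_not, LDesc, not_rDesc, h]
  constructor
  · rintro (h | ⟨-, h⟩)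
    · exact h
    · exact absurd h hlt.asymm
  · exact .inl

lemma DescOff.lt {j : ℕ} {w : Equiv.Perm (Fin n)} (h : DescOff j w) {p q : Fin n} (hpq : p < q)
    (hj : (q : ℕ) < j ∨ j ≤ p) : w q < w p := by
  obtain ⟨p, hp⟩ := p
  obtain ⟨q, hq⟩ := q
  simp only [Fin.mk_lt_mk] at hpq hj
  induction q, hpq using Nat.le_induction with
  | base => exact h ⟨p, by omega⟩ (by simp; omega)
  | succ q hpq ih =>
    exact lt_trans (h ⟨q, by omega⟩ (by simp; omega)) (ih (by omega) (by omega))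

lemma DescOff.sorts {j : ℕ} {w : Equiv.Perm (Fin n)} (h : DescOff j w) :
    Sorts (Finset.univ.filter fun x => (w⁻¹ x : ℕ) < j) w := by
  have key : ∀ x y, w⁻¹ x < w⁻¹ y → ((w⁻¹ y : ℕ) < j ∨ j ≤ w⁻¹ x) → y < x := fun x y hxy hj => by
    simpa using h.lt hxy hj
  intro x y
  simp only [Finset.mem_filter, Finset.mem_univ, true_and, not_lt]
  have h1 := key x y
  have h2 := key y x
  have h3 : w⁻¹ x = w⁻¹ y → x = y := fun h => w⁻¹.injective h
  rw [Fin.lt_def] at *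
  rw [Fin.lt_def] at h1 h2
  rw [Fin.ext_iff, Fin.ext_iff] at h3
  omega

-- A permutation descending everywhere except possibly after its first `j` entries is determined by
-- the set `A` of those entries. Its left descents can be read off from `A`: a value precedes its
-- successor only when `A` contains it and not the successor.
open scoped Classical in
lemma sum_descOff {j : ℕ} (hj : j ≤ n) (g : (Fin (n - 1) → Prop) → ℕ) :
    ∑ w : Equiv.Perm (Fin n) with DescOff j w, g (LDesc w) =
      ∑ A ∈ Finset.powersetCard j (Finset.univ : Finset (Fin n)), g (NotLeaving A) := by
  refine Finset.sum_bij (fun w _ => Finset.univ.filter fun x => (w⁻¹ x : ℕ) < j) ?_ ?_ ?_ ?_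
  · intro w _
    simp [Finset.mem_powersetCard, card_filter_perm_lt _ hj]
  · intro w hw w' hw' e
    have h := (Finset.mem_filter.1 hw).2.sorts
    rw [e] at h
    exact h.eq (Finset.mem_filter.1 hw').2.sorts
  · intro A hA
    obtain ⟨w, hw⟩ := exists_sorts A
    have hAj := (Finset.mem_powersetCard.1 hA).2
    have hd : DescOff j w := hAj ▸ hw.descOff
    refine ⟨w, by simpa using hd, hd.sorts.eq_of_card_eq hw ?_⟩
    rw [card_filter_perm_lt _ hj, hAj]
  · intro w hw
    congr 1
    funext i
    exact propext ((Finset.mem_filter.1 hw).2.sorts.lDesc_iff i)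

open scoped Classical in
/-- The number of permutations whose descents include all elements of `D`. -/
noncomputable def numDesc (D : Fin (n - 1) → Prop) : ℕ :=
  Finset.card {w : Equiv.Perm (Fin n) | HasDesc D w}

lemma numDesc_univ : numDesc (NotLeaving (Finset.univ : Finset (Fin n))) = 1 := by
  classical
  rw [numDesc, Finset.card_eq_one]
  refine ⟨Fin.revPerm, ?_⟩
  ext w
  simp only [HasDesc, NotLeaving, Finset.mem_univ, not_true_eq_false, and_false, not_false_eq_true,
    forall_const, Finset.mem_filter, true_and, Finset.mem_singleton]
  constructor
  · intro h
    by_contra hne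
    obtain ⟨i, hi⟩ := exists_not_rDesc hne
    exact hi (h i)
  · rintro rfl i
    exact Fin.rev_lt_rev.2 (lo_lt_hi i)

/-- `sum_descOff` is applied twice, to the third and then to the second factor, leaving a sum over
proper subsets. The `+ 1` accounts for the full set. -/
theorem numBraids_four_delta_pred (hn : 1 ≤ n) :
    numBraids n 4 (Delta n (n - 1) (Nat.sub_le n 1)) + 1 =
      ∑ A : Finset (Fin n), numDesc (NotLeaving A) := by
  classical
  rw [numBraids_four (isSimple_delta _ _), Nat.card_eq_fintype_card, Fintype.card_subtype,
    Finset.card_filter, Fintype.sum_prod_type_right, Fintype.sum_prod_type_right]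
  let F : (Fin (n - 1) → Prop) → ℕ := fun D =>
    ∑ w : Equiv.Perm (Fin n), if HasDesc D w then numDesc (LDesc w) else 0
  have h1 : ∀ w : Equiv.Perm (Fin n), (∑ v : Equiv.Perm (Fin n), ∑ u : Equiv.Perm (Fin n),
      if Follows u v ∧ Follows v w ∧ Follows w (toPerm (Delta n (n - 1) (Nat.sub_le n 1)))
        then 1 else 0) = if DescOff (n - 1) w then F (LDesc w) else 0 := by
    intro w
    have hw : Follows w (toPerm (Delta n (n - 1) (Nat.sub_le n 1))) ↔ DescOff (n - 1) w := by
      simp only [Follows, lDesc_toPerm_delta_pred, DescOff, HasDesc]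
    rw [hw]
    split_ifs with hd
    · refine Finset.sum_congr rfl fun v _ => ?_
      simp only [hd, follows_eq, and_true]
      split_ifs with hv
      · simp only [hv, and_true, numDesc, Finset.card_filter]
      · simp [hv]
    · simp [hd]
  simp only [h1]
  rw [← Finset.sum_filter, sum_descOff (Nat.sub_le n 1)]
  -- A set of size `n - 1` omits one point `k`, and it can be left only by stepping onto `k`.
  have h2 : ∑ A ∈ Finset.powersetCard (n - 1) (Finset.univ : Finset (Fin n)), F (NotLeaving A) =
      ∑ k : Fin n, F (fun i => (i : ℕ) + 1 ≠ k) := by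
    symm
    refine Finset.sum_bij (fun k _ => {k}ᶜ) ?_ ?_ ?_ ?_
    · intro k _
      simp [Finset.mem_powersetCard, Finset.card_compl]
    · intro k _ k' _ h
      simpa using h
    · intro A hA
      have hA := (Finset.mem_powersetCard.1 hA).2
      have : Aᶜ.card = 1 := by rw [Finset.card_compl, hA, Fintype.card_fin]; omega
      obtain ⟨k, hk⟩ := Finset.card_eq_one.1 this
      exact ⟨k, Finset.mem_univ _, by rw [← hk, compl_compl]⟩
    · intro k _
      congr 1
      funext i
      simp only [NotLeaving, Finset.mem_compl, Finset.mem_singleton, Fin.ext_iff, val_lo, val_hi,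
        eq_iff_iff]
      omega
  have h3 : ∀ k : Fin n, F (fun i => (i : ℕ) + 1 ≠ k) =
      ∑ A ∈ Finset.powersetCard k (Finset.univ : Finset (Fin n)), numDesc (NotLeaving A) :=
    fun k => by rw [← sum_descOff k.2.le numDesc, Finset.sum_filter]; simp only [F, DescOff]; congr!
  rw [h2, Finset.sum_congr rfl (fun k _ => h3 k), ← Finset.powerset_univ, Finset.sum_powerset,
    Finset.card_fin, Finset.sum_range_succ,
    ← Fin.sum_univ_eq_sum_range (fun k => ∑ A ∈ Finset.powersetCard k
      (Finset.univ : Finset (Fin n)), numDesc (NotLeaving A))]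
  congr 1
  have := Finset.powersetCard_self (Finset.univ : Finset (Fin n))
  rw [Finset.card_fin] at this
  rw [this, Finset.sum_singleton, numDesc_univ]

end BraidMonoid

/-! ### Marked words and their recursion. -/

/-- Two marked letters may be consecutive if they decrease, or if the first is marked
and the second is not. -/
def MarkedStep (p q : ℕ × Bool) : Prop := (p.2 = true ∧ q.2 = false) ∨ q.1 < p.1

instance : DecidableRel MarkedStep := fun _ _ => inferInstanceAs (Decidable (_ ∨ _))

/-- The marked words in `m` letters, each letter of `S` being used once, that may follow the
marked letter `p`. -/
def markedWords : ℕ → Finset ℕ → ℕ × Bool → Finset (List (ℕ × Bool))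
  | 0, _, _ => {[]}
  | m + 1, S, p =>
      ((S ×ˢ Finset.univ).filter (MarkedStep p)).biUnion fun q =>
        (markedWords m (S.erase q.1) q).map ⟨List.cons q, List.cons_injective⟩

lemma mem_markedWords {m : ℕ} {S : Finset ℕ} (hS : S.card = m) {p : ℕ × Bool}
    {l : List (ℕ × Bool)} : l ∈ markedWords m S p ↔
      (l.map Prod.fst).Nodup ∧ (l.map Prod.fst).toFinset = S ∧ (p :: l).IsChain MarkedStep := by
  induction m generalizing S p l with
  | zero =>
    obtain rfl := Finset.card_eq_zero.1 hS
    cases l <;> simp [markedWords]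
  | succ m ih =>
    have hne : S ≠ ∅ := by rintro rfl; simp at hS
    simp only [markedWords, Finset.mem_biUnion, Finset.mem_filter, Finset.mem_product,
      Finset.mem_univ, and_true, Finset.mem_map, Function.Embedding.coeFn_mk]
    constructor
    · rintro ⟨q, ⟨hq, hpq⟩, l, hl, rfl⟩
      rw [ih (by rw [Finset.card_erase_of_mem hq, hS]; rfl)] at hl
      obtain ⟨h1, h2, h3⟩ := hl
      refine ⟨?_, ?_, ?_⟩
      · rw [List.map_cons, List.nodup_cons]
        refine ⟨fun h => ?_, h1⟩
        have := List.mem_toFinset.2 h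
        rw [h2] at this
        simp at this
      · rw [List.map_cons, List.toFinset_cons, h2, Finset.insert_erase hq]
      · exact List.isChain_cons_cons.2 ⟨hpq, h3⟩
    · rintro ⟨h1, h2, h3⟩
      cases l with
      | nil => exact absurd h2.symm hne
      | cons q l =>
        rw [List.map_cons, List.nodup_cons] at h1
        rw [List.map_cons, List.toFinset_cons] at h2
        rw [List.isChain_cons_cons] at h3
        have hq : q.1 ∈ S := h2 ▸ Finset.mem_insert_self _ _
        refine ⟨q, ⟨hq, h3.1⟩, l, ?_, rfl⟩
        rw [ih (by rw [Finset.card_erase_of_mem hq, hS]; rfl)]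
        refine ⟨h1.2, ?_, h3.2⟩
        rw [← h2, Finset.erase_insert (by simpa using h1.1)]

lemma card_markedWords_succ (m : ℕ) (S : Finset ℕ) (p : ℕ × Bool) :
    (markedWords (m + 1) S p).card =
      ∑ b ∈ S, ∑ d : Bool,
        if MarkedStep p (b, d) then (markedWords m (S.erase b) (b, d)).card else 0 := by
  rw [markedWords, Finset.card_biUnion, Finset.sum_filter, Finset.sum_product]
  · simp only [Finset.card_map]
  · intro q _ q' _ hne
    refine Finset.disjoint_left.2 fun l hl hl' => ?_
    simp only [Finset.mem_map, Function.Embedding.coeFn_mk] at hl hl'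
    obtain ⟨l, -, rfl⟩ := hl
    obtain ⟨l', -, h⟩ := hl'
    exact hne (List.cons.inj h).1.symm

/-- The rank of `b` in `T` takes each value below the size of `T` once. -/
lemma sum_card_filter_lt (T : Finset ℕ) (f : ℕ → ℕ) :
    ∑ b ∈ T, f (T.filter (· < b)).card = ∑ r ∈ Finset.range T.card, f r := by
  induction T using Finset.induction_on_max with
  | empty => simp
  | insert a T ha ih =>
    have haT : a ∉ T := fun h => lt_irrefl _ (ha a h)
    rw [Finset.sum_insert haT, Finset.card_insert_of_notMem haT, Finset.sum_range_succ, ← ih,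
      add_comm]
    congr 1
    · refine Finset.sum_congr rfl fun b hb => ?_
      rw [Finset.filter_insert, if_neg (ha b hb).asymm]
    · rw [Finset.filter_insert, if_neg (lt_irrefl a), Finset.filter_true_of_mem ha]

lemma sum_filter_lt_card_filter_lt (S : Finset ℕ) (a : ℕ) (f : ℕ → ℕ) :
    (∑ b ∈ S, if b < a then f (S.filter (· < b)).card else 0) =
      ∑ r ∈ Finset.range (S.filter (· < a)).card, f r := by
  rw [← Finset.sum_filter, ← sum_card_filter_lt]
  refine Finset.sum_congr rfl fun b hb => ?_
  rw [Finset.filter_filter]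
  congr 2
  ext x
  have := (Finset.mem_filter.1 hb).2
  simp only [Finset.mem_filter]
  exact and_congr_right fun _ => ⟨fun h => ⟨h.trans this, h⟩, fun h => h.2⟩

/-- The number of marked words in `m` letters following an unmarked (`false`) or marked (`true`)
letter that is larger than exactly `r` of them. -/
def numMarked : ℕ → Bool → ℕ → ℕ
  | 0, _, _ => 1
  | m + 1, false, r =>
      ∑ k ∈ Finset.range r, numMarked m true k + ∑ k ∈ Finset.range r, numMarked m false k
  | m + 1, true, r =>
      ∑ k ∈ Finset.range r, numMarked m true k + ∑ k ∈ Finset.range (m + 1), numMarked m false k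

/-- The count depends on the last letter only through its mark and its rank among the remaining
letters. Choosing the next letter amounts to choosing its rank: below the current one for a descent,
arbitrary for a step from marked to unmarked. -/
lemma card_markedWords {m : ℕ} {S : Finset ℕ} (hS : S.card = m) (a : ℕ) (c : Bool) :
    (markedWords m S (a, c)).card = numMarked m c (S.filter (· < a)).card := by
  induction m generalizing S a c with
  | zero => simp [markedWords, numMarked]
  | succ m ih =>
    have h1 : ∀ b ∈ S, ∀ d, (markedWords m (S.erase b) (b, d)).card =
        numMarked m d (S.filter (· < b)).card := by
      intro b hb d
      rw [ih (by rw [Finset.card_erase_of_mem hb, hS]; rfl)]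
      congr 2
      ext x
      simp only [Finset.mem_filter, Finset.mem_erase]
      constructor
      · rintro ⟨⟨-, h⟩, h'⟩; exact ⟨h, h'⟩
      · rintro ⟨h, h'⟩; exact ⟨⟨h'.ne, h⟩, h'⟩
    rw [card_markedWords_succ]
    simp only [Fintype.sum_bool]
    rw [Finset.sum_add_distrib]
    have h2 : ∀ d, (∑ b ∈ S, if b < a then (markedWords m (S.erase b) (b, d)).card else 0) =
        ∑ r ∈ Finset.range (S.filter (· < a)).card, numMarked m d r := fun d => by
      rw [← sum_filter_lt_card_filter_lt]
      exact Finset.sum_congr rfl fun b hb => by rw [h1 b hb]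
    have h3 : ∑ b ∈ S, (markedWords m (S.erase b) (b, false)).card =
        ∑ r ∈ Finset.range (m + 1), numMarked m false r := by
      rw [← hS, ← sum_card_filter_lt]
      exact Finset.sum_congr rfl fun b hb => h1 b hb false
    cases c with
    | false =>
      simp only [MarkedStep, Bool.false_eq_true, false_and, false_or, numMarked]
      rw [h2, h2]
    | true =>
      simp only [MarkedStep, true_and, Bool.true_eq_false, false_or, true_or, if_true, numMarked]
      rw [h2, h3]

/-! ### Closed form of the count. -/

lemma succ_mul_choose_mul_factorial {n k : ℕ} (h : k < n) :
    (k + 1) * (n.choose (k + 1) * (n - (k + 1)).factorial) = n.choose k * (n - k).factorial := by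
  have h1 := Nat.choose_succ_right_eq n k
  have h2 : (n - k).factorial = (n - k) * (n - (k + 1)).factorial := by
    rw [show n - k = (n - (k + 1)) + 1 by omega, Nat.factorial_succ]
  rw [h2]
  calc _ = (n.choose (k + 1) * (k + 1)) * (n - (k + 1)).factorial := by ring
    _ = _ := by rw [h1]; ring

/-- With a_k = C(n,k)(n-k)!, the relation (k+1) a_{k+1} = a_k gives k a_{k+1} = a_k - a_{k+1}, and
the sum telescopes. -/
lemma sum_mul_choose_mul_factorial (n K : ℕ) (h : K ≤ n) :
    ∑ k ∈ Finset.range K, k * (n.choose (k + 1) * (n - (k + 1)).factorial) +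
      n.choose K * (n - K).factorial = n.factorial := by
  induction K with
  | zero => simp
  | succ K ih =>
    rw [← ih (by omega), Finset.sum_range_succ, ← succ_mul_choose_mul_factorial h]
    ring

lemma sum_range_choose_eq (R k : ℕ) : ∑ r ∈ Finset.range R, r.choose k = R.choose (k + 1) := by
  induction R with
  | zero => simp
  | succ R ih => rw [Finset.sum_range_succ, ih, Nat.choose_succ_succ', add_comm]

/-- Closed form of the number of marked words following a marked letter. -/
def closedMarked (m r : ℕ) : ℕ := ∑ k ∈ Finset.range (m + 1), r.choose k * (m - k).factorial

/-- Closed form of the number of marked words following an unmarked letter, up to the word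
consisting of unmarked letters only. -/
def closedUnmarked (m r : ℕ) : ℕ :=
  ∑ k ∈ Finset.range (m + 1), k * (r.choose k * (m - k).factorial)

/-- Hockey-stick summation shifts the index `k` by one; the factorial supplies the missing term `k =
0`. -/
lemma sum_closedMarked (m r : ℕ) :
    ∑ j ∈ Finset.range r, closedMarked m j + (m + 1).factorial = closedMarked (m + 1) r := by
  simp only [closedMarked]
  rw [Finset.sum_comm, Finset.sum_range_succ' _ (m + 1)]
  simp only [← Finset.sum_mul, sum_range_choose_eq]
  simp

lemma sum_closedMarked_add_closedUnmarked (m r : ℕ) :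
    ∑ j ∈ Finset.range r, closedMarked m j + ∑ j ∈ Finset.range r, closedUnmarked m j =
      closedUnmarked (m + 1) r := by
  simp only [closedMarked, closedUnmarked]
  rw [Finset.sum_comm, Finset.sum_comm (s := Finset.range r), Finset.sum_range_succ' _ (m + 1)]
  simp only [← Finset.mul_sum, ← Finset.sum_mul, sum_range_choose_eq, ← Finset.sum_add_distrib]
  simp only [zero_mul, add_zero, Nat.add_sub_add_right]
  exact Finset.sum_congr rfl fun k _ => by ring

lemma sum_closedUnmarked_self (m : ℕ) :
    ∑ j ∈ Finset.range (m + 1), closedUnmarked m j + 1 = (m + 1).factorial := by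
  have h := sum_mul_choose_mul_factorial (m + 1) (m + 1) le_rfl
  simp only [Nat.choose_self, Nat.sub_self, Nat.factorial_zero, mul_one] at h
  rw [← h]
  simp only [closedUnmarked]
  rw [Finset.sum_comm]
  simp only [← Finset.mul_sum, ← Finset.sum_mul, sum_range_choose_eq, Nat.add_sub_add_right]

/-- After a marked letter, the unmarked continuations number `(m + 1)!` whatever `r` is, by
`sum_closedUnmarked_self` and the correction at `r = m`. This is just the term `sum_closedMarked`
requires. -/
theorem numMarked_eq {m r : ℕ} (h : r ≤ m) :
    numMarked m true r = closedMarked m r ∧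
      numMarked m false r = closedUnmarked m r + if r = m then 1 else 0 := by
  induction m generalizing r with
  | zero =>
    obtain rfl := Nat.le_zero.1 h
    simp [numMarked, closedMarked, closedUnmarked]
  | succ m ih =>
    have h1 : ∑ k ∈ Finset.range r, numMarked m true k =
        ∑ k ∈ Finset.range r, closedMarked m k :=
      Finset.sum_congr rfl fun k hk => (ih (by have := Finset.mem_range.1 hk; omega)).1
    have h2 : ∀ r ≤ m + 1, ∑ k ∈ Finset.range r, numMarked m false k =
        ∑ k ∈ Finset.range r, closedUnmarked m k + if r = m + 1 then 1 else 0 := by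
      intro r hr
      rw [Finset.sum_congr rfl
        fun k hk => (ih (by have := Finset.mem_range.1 hk; omega)).2, Finset.sum_add_distrib]
      congr 1
      rw [Finset.sum_ite_eq' (Finset.range r) m (fun _ => 1)]
      simp only [Finset.mem_range]
      split_ifs <;> omega
    constructor
    · rw [numMarked, h1, h2 _ le_rfl, if_pos rfl, sum_closedUnmarked_self, sum_closedMarked]
    · rw [numMarked, h1, h2 r h, ← add_assoc, sum_closedMarked_add_closedUnmarked]

theorem numMarked_self (n : ℕ) :
    numMarked n false n = ∑ k ∈ Finset.range (n + 1), n.choose k * (n - k).factorial := by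
  rw [(numMarked_eq le_rfl).2, if_pos rfl, closedUnmarked, Finset.sum_range_succ',
    Finset.sum_range_succ]
  simp only [zero_mul, add_zero, Nat.choose_self, Nat.sub_self, Nat.factorial_zero, mul_one]
  congr 1
  exact Finset.sum_congr rfl fun k hk => succ_mul_choose_mul_factorial (Finset.mem_range.1 hk)

/-! ### Marked words as pairs of a subset and a permutation. -/

namespace BraidMonoid

variable {n : ℕ}

/-- The marked word of a permutation and a set of positions. -/
def markedWord (A : Finset (Fin n)) (w : Equiv.Perm (Fin n)) : List (ℕ × Bool) :=
  List.ofFn fun p => ((w p : ℕ), decide (p ∈ A))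

lemma isChain_markedWord {A : Finset (Fin n)} {w : Equiv.Perm (Fin n)} :
    ((n, false) :: markedWord A w).IsChain MarkedStep ↔ HasDesc (NotLeaving A) w := by
  -- The initial letter `n` exceeds all others, so it puts no restriction on the first actual
  -- letter.
  have h1 : ∀ q ∈ (markedWord A w).head?, MarkedStep (n, false) q := by
    intro q hq
    have hq := List.mem_of_mem_head? hq
    rw [markedWord, List.mem_ofFn] at hq
    obtain ⟨p, rfl⟩ := hq
    exact .inr (w p).2
  rw [List.isChain_cons, and_iff_right h1, markedWord, List.isChain_ofFn]
  have key : ∀ i : Fin (n - 1), MarkedStep ((w (lo i) : ℕ), decide (lo i ∈ A))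
      ((w (hi i) : ℕ), decide (hi i ∈ A)) ↔ (NotLeaving A i → RDesc w i) := by
    intro i
    simp only [MarkedStep, decide_eq_true_eq, decide_eq_false_iff_not, NotLeaving, RDesc,
      Fin.lt_def]
    tauto
  constructor
  · intro h i
    exact (key i).1 (h i (by omega))
  · intro h i hi
    exact (key ⟨i, by omega⟩).2 (h ⟨i, by omega⟩)

lemma map_fst_markedWord (A : Finset (Fin n)) (w : Equiv.Perm (Fin n)) :
    (markedWord A w).map Prod.fst = List.ofFn fun p => (w p : ℕ) := by
  rw [markedWord, List.map_ofFn]; rfl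

lemma markedWord_mem_iff {A : Finset (Fin n)} {w : Equiv.Perm (Fin n)} :
    markedWord A w ∈ markedWords n (Finset.range n) (n, false) ↔ HasDesc (NotLeaving A) w := by
  rw [mem_markedWords (Finset.card_range n), isChain_markedWord, map_fst_markedWord,
    List.nodup_ofFn]
  have h1 : Function.Injective fun p => (w p : ℕ) := Fin.val_injective.comp w.injective
  have h2 : (List.ofFn fun p => (w p : ℕ)).toFinset = Finset.range n := by
    ext x
    simp only [List.mem_toFinset, List.mem_ofFn, Finset.mem_range]
    constructor
    · rintro ⟨p, rfl⟩; exact (w p).2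
    · intro hx; exact ⟨w⁻¹ ⟨x, hx⟩, by simp⟩
  rw [and_iff_right h1, and_iff_right h2]

lemma exists_markedWord_eq {l : List (ℕ × Bool)}
    (hl : l ∈ markedWords n (Finset.range n) (n, false)) : 
    ∃ (A : Finset (Fin n)) (w : Equiv.Perm (Fin n)), markedWord A w = l := by
  rw [mem_markedWords (Finset.card_range n)] at hl
  obtain ⟨h1, h2, -⟩ := hl
  have hlen : l.length = n := by
    rw [← List.length_map (f := Prod.fst), ← List.toFinset_card_of_nodup h1, h2,
      Finset.card_range]
  subst hlen
  have hlt : ∀ p : Fin l.length, (l.get p).1 < l.length := fun p => by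
    rw [← Finset.mem_range, ← h2, List.mem_toFinset]
    exact List.mem_map_of_mem (List.get_mem l p)
  let w : Fin l.length → Fin l.length := fun p => ⟨_, hlt p⟩
  have hw : Function.Injective w := by
    intro p q hpq
    have hpq : (l.get p).1 = (l.get q).1 := congrArg Fin.val hpq
    have := (List.nodup_iff_injective_get.1 h1) (a₁ := p.cast (by simp)) (a₂ := q.cast (by simp))
      (by simpa using hpq)
    simpa [Fin.ext_iff] using this
  refine ⟨Finset.univ.filter fun p => (l.get p).2 = true,
    Equiv.ofBijective w (Finite.injective_iff_bijective.1 hw), ?_⟩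
  rw [markedWord]
  conv_rhs => rw [← List.ofFn_get l]
  congr 1
  funext p
  simp [w]

theorem sum_numDesc : ∑ A : Finset (Fin n), numDesc (NotLeaving A) =
    ∑ k ∈ Finset.range (n + 1), n.choose k * (n - k).factorial := by
  classical
  have h := card_markedWords (Finset.card_range n) n false
  rw [Finset.filter_true_of_mem (fun x hx => Finset.mem_range.1 hx), Finset.card_range,
    numMarked_self] at h
  rw [← h]
  simp only [numDesc]
  rw [← Finset.card_sigma]
  refine Finset.card_bij (fun t _ => markedWord t.1 t.2) ?_ ?_ ?_
  · rintro ⟨A, w⟩ ht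
    rw [markedWord_mem_iff]
    simpa using ht
  · rintro ⟨A, w⟩ - ⟨B, v⟩ - e
    have e := List.ofFn_injective e
    have h1 : w = v := Equiv.ext fun p => Fin.ext (congrArg Prod.fst (congrFun e p))
    have h2 : A = B := Finset.ext fun p => by
      simpa using congrArg Prod.snd (congrFun e p)
    rw [h1, h2]
  · intro l hl
    obtain ⟨A, w, rfl⟩ := exists_markedWord_eq hl
    exact ⟨⟨A, w⟩, by simpa using markedWord_mem_iff.1 hl, rfl⟩

end BraidMonoid

/-! ### Recursion and comparison with `n! e`. -/

lemma sum_choose_mul_factorial_succ (n : ℕ) :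
    ∑ k ∈ Finset.range (n + 1 + 1), (n + 1).choose k * (n + 1 - k).factorial =
      (n + 1) * ∑ k ∈ Finset.range (n + 1), n.choose k * (n - k).factorial + 1 := by
  rw [Finset.sum_range_succ, Finset.mul_sum]
  congr 1
  · refine Finset.sum_congr rfl fun k hk => ?_
    have hk := Finset.mem_range.1 hk
    rw [show n + 1 - k = n - k + 1 by omega, Nat.factorial_succ, ← mul_assoc, ← mul_assoc]
    congr 1
    have := Nat.choose_mul_succ_eq n k
    rw [show n - k + 1 = n + 1 - k by omega]
    linarith
  · simp

lemma cast_sum_choose_mul_factorial (n : ℕ) :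
    ((∑ k ∈ Finset.range (n + 1), n.choose k * (n - k).factorial : ℕ) : ℝ) =
      n.factorial * ∑ k ∈ Finset.range (n + 1), (1 : ℝ) ^ k / k.factorial := by
  push_cast
  rw [Finset.mul_sum]
  refine Finset.sum_congr rfl fun k hk => ?_
  have hk := Nat.lt_succ_iff.1 (Finset.mem_range.1 hk)
  have := Nat.choose_mul_factorial_mul_factorial hk
  rw [one_pow, mul_one_div, eq_div_iff (by positivity), ← this]
  push_cast
  ring

lemma floor_factorial_mul_exp_one {n : ℕ} (hn : 1 ≤ n) :
    ⌊(n.factorial : ℝ) * Real.exp 1⌋ =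
      ((∑ k ∈ Finset.range (n + 1), n.choose k * (n - k).factorial : ℕ) : ℤ) := by
  rw [Int.floor_eq_iff, Int.cast_natCast, cast_sum_choose_mul_factorial]
  have hpos : (0 : ℝ) < n.factorial := by positivity
  constructor
  · exact mul_le_mul_of_nonneg_left (Real.sum_le_exp_of_nonneg zero_le_one _) hpos.le
  -- Multiplied by `n!`, the remainder bound becomes (n+2)/(n+1)², which is below 1 exactly because
  -- `n ≥ 1`.
  · have h := Real.exp_bound' zero_le_one le_rfl (n := n + 1) (Nat.succ_pos n)
    have h2 := mul_le_mul_of_nonneg_left h hpos.le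
    refine h2.trans_lt ?_
    rw [mul_add]
    refine add_lt_add_right ?_ _
    rw [Nat.factorial_succ]
    push_cast
    have hn' : (1 : ℝ) ≤ n := by exact_mod_cast hn
    rw [one_pow, one_mul, mul_div_assoc', div_lt_one (by positivity)]
    have : (n : ℝ) + 1 + 1 < (n + 1) * (n + 1) := by nlinarith
    calc (n.factorial : ℝ) * (n + 1 + 1) < n.factorial * ((n + 1) * (n + 1)) := by gcongr
      _ = _ := by ring

theorem corollary4p7 (u : ℕ → ℕ)
    (hu : ∀ n : ℕ, 1 ≤ n → u n =
      BraidMonoid.numBraids n 4 (BraidMonoid.Delta n (n - 1) (Nat.sub_le n 1))) :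
    (u 1 = 1 ∧ ∀ n : ℕ, 2 ≤ n → u n = n * u (n - 1) + n) ∧
      ∀ n : ℕ, 1 ≤ n → (u n : ℤ) = ⌊(Nat.factorial n : ℝ) * Real.exp 1⌋ - 1 := by
  have key : ∀ n, 1 ≤ n →
      u n + 1 = ∑ k ∈ Finset.range (n + 1), n.choose k * (n - k).factorial := fun n hn => by
    rw [hu n hn, BraidMonoid.numBraids_four_delta_pred hn, BraidMonoid.sum_numDesc]
  refine ⟨⟨?_, fun n hn => ?_⟩, fun n hn => ?_⟩
  · have := key 1 le_rfl
    simpa [Finset.sum_range_succ] using this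
  · obtain ⟨m, rfl⟩ : ∃ m, n = m + 1 := ⟨n - 1, by omega⟩
    have h1 := key (m + 1) (by omega)
    rw [sum_choose_mul_factorial_succ, ← key m (by omega)] at h1
    rw [Nat.add_sub_cancel]
    linarith
  · rw [floor_factorial_mul_exp_one hn, ← key n hn]
    simp
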